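/- There is an algorithm that solves Unweighted Min Stable Cut exactly in time $\Delta^{O(\mathrm{tw})}(n+N)^{O(1)}$, where the input is a finite simple graph $G$ with $n$ vertices and maximum degree $\Delta$ (with $\Delta$ replaced by $1$ in this bound if $G$ has no edges), together with a tree decomposition of $G$ of width $\mathrm{tw}$ with $N$ nodes; so the time is $\Delta^{O(\mathrm{tw})}n^{O(1)}$ for decompositions with $N\le n^{O(1)}$ nodes. Here a cut of $G=(V,E)$ is a partition of $V$ into two (possibly empty) sets $V_0,V_1$; it is stable if every vertex $v$ has at least $\deg(v)/2$ of its neighbors on the side that does not contain $v$; and to solve Unweighted Min Stable Cut on $G$ is to return a stable cut with the minimum number of edges between $V_0$ and $V_1$. The width of a tree decomposition is the maximum size of its bags minus one (and $0$ if all bags are empty). Precisely: there are one program $P$ and one constant $c$ such that for every such $G$ with vertex set $\{0,\dots,n-1\}$ and every such tree decomposition, the program $P$, given the adjacency matrices of $G$ and of the tree of the decomposition and the characteristic vectors of the bags, halts with a minimum stable cut of $G$ as its output, after at most $c\cdot\max(\Delta,1)^{c\cdot\mathrm{tw}}\cdot(n+N)^{c}$ steps. Programs are while programs over binary trees (finitely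 many variables, each holding a pointer to a binary tree; assignment, sequence, branching, while loop), where creating a cell, accessing a component of a cell, testing for a leaf, and assigning a variable take one step each; up to a polynomial, the number of steps is the running time on Turing machines or random access machines. -/

import Mathlib

/-! ### Weighted graphs, cuts and the problem Min Stable Cut -/

namespace MinStableCut

section Cuts

variable {V : Type*} [Fintype V] [DecidableEq V]
  (G : SimpleGraph V) [DecidableRel G.Adj] (w : Sym2 V → ℕ)

/-- The weighted degree `d_w(v)`: the total weight of the edges incident on `v`. -/
def weightedDegree (v : V) : ℕ :=
  ∑ u ∈ G.neighborFinset v, w s(v, u)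

/-- The total weight of the edges incident on `v` that are cut. A cut, that is a partition of the
vertices into `V₀` and `V₁`, is given by the map `side` that sends the vertices of `V₀` to `false`
and those of `V₁` to `true`. -/
def crossingWeight (side : V → Bool) (v : V) : ℕ :=
  ∑ u ∈ G.neighborFinset v with side u ≠ side v, w s(v, u)

/-- A cut is stable for `v` if the cut edges at `v` weigh at least half the weighted degree. -/
def IsStableAt (side : V → Bool) (v : V) : Prop :=
  (weightedDegree G w v : ℚ) / 2 ≤ (crossingWeight G w side v : ℚ)

/-- A cut is stable if it is stable for all vertices. -/
def IsStable (side : V → Bool) : Prop :=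
  ∀ v, IsStableAt G w side v

/-- The weight of a cut: the sum of the weights of the edges with endpoints on both sides. -/
def cutWeight (side : V → Bool) : ℕ :=
  ∑ e ∈ G.edgeFinset with (∃ u ∈ e, ∃ v ∈ e, side u ≠ side v), w e

/-- The optimal solutions of Min Stable Cut: the stable cuts of minimum weight. -/
def IsOptimal (side : V → Bool) : Prop :=
  IsStable G w side ∧ ∀ side' : V → Bool, IsStable G w side' → cutWeight G w side ≤ cutWeight G w side'

/-- The optimal solutions of Unweighted Min Stable Cut, where all edges have weight one. -/
def IsUnweightedOptimal (side : V → Bool) : Prop :=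
  IsOptimal G (fun _ => 1) side

end Cuts

/-! ### Tree decompositions -/

/-- A tree decomposition of `G` whose tree has node set `ι`. -/
structure TreeDecomposition {V : Type*} (G : SimpleGraph V) (ι : Type*) where
  /-- the tree on the nodes of the decomposition -/
  tree : SimpleGraph ι
  isTree : tree.IsTree
  /-- the bag of each node -/
  bag : ι → Finset V
  exists_mem_bag : ∀ v, ∃ t, v ∈ bag t
  exists_edge_bag : ∀ u v, G.Adj u v → ∃ t, u ∈ bag t ∧ v ∈ bag t
  connected : ∀ v, (tree.induce {t | v ∈ bag t}).Connected

/-- The width of a tree decomposition: the largest size of a bag, minus one. -/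
def TreeDecomposition.width {V : Type*} {G : SimpleGraph V} {ι : Type*} [Fintype ι]
    (D : TreeDecomposition G ι) : ℕ :=
  (Finset.univ.sup fun t => (D.bag t).card) - 1

/-! ### The machine model

While programs over binary trees (the language WHILE of N. Jones, "Computability and Complexity
from a Programming Perspective"). A program has finitely many variables, each of which holds (a
pointer to) a binary tree, and it is charged one step for every single operation on pointers: the
creation of a cell, the access to one of the two components of a cell, the test whether a tree is
a leaf, an assignment. There is no arithmetic and no comparison of trees in unit time. Up to a
polynomial, the running time in this model is that of Turing machines or random access machines
of logarithmic cost. -/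

/-- The data of the programs. -/
inductive Data : Type
  | nil : Data
  | cons (l r : Data) : Data

/-- The left component; that of `nil` is `nil`. -/
def Data.hd : Data → Data
  | nil => nil
  | cons l _ => l

/-- The right component; that of `nil` is `nil`. -/
def Data.tl : Data → Data
  | nil => nil
  | cons _ r => r

/-- A store assigns a tree to every variable; variables are numbered. -/
abbrev Store : Type := ℕ → Data

/-- The expressions of the programming language. -/
inductive Term : Type
  | var (i : ℕ) : Term
  | nil : Term
  | cons (a b : Term) : Term
  | hd (a : Term) : Term
  | tl (a : Term) : Term

/-- The value of an expression. -/
def Term.eval (σ : Store) : Term → Data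
  | var i => σ i
  | nil => Data.nil
  | cons a b => Data.cons (a.eval σ) (b.eval σ)
  | hd a => (a.eval σ).hd
  | tl a => (a.eval σ).tl

/-- The number of steps that the evaluation of an expression takes. -/
def Term.cost : Term → ℕ
  | var _ => 1
  | nil => 1
  | cons a b => a.cost + b.cost + 1
  | hd a => a.cost + 1
  | tl a => a.cost + 1

/-- The programs: assignment, sequence, branching and loop. A condition holds if its value is
not `nil`. -/
inductive Program : Type
  | assign (i : ℕ) (a : Term) : Program
  | seq (p q : Program) : Program
  | ite (a : Term) (p q : Program) : Program
  | loop (a : Term) (p : Program) : Program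

/-- `p.Runs σ σ' t`: the program `p`, started in the store `σ`, halts after `t` steps in the
store `σ'`. -/
inductive Program.Runs : Program → Store → Store → ℕ → Prop
  | assign (i : ℕ) (a : Term) (σ : Store) :
      Runs (assign i a) σ (Function.update σ i (a.eval σ)) (a.cost + 1)
  | seq {p q : Program} {σ σ' σ'' : Store} {t t' : ℕ} :
      Runs p σ σ' t → Runs q σ' σ'' t' → Runs (seq p q) σ σ'' (t + t')
  | ite_true {a : Term} {p q : Program} {σ σ' : Store} {t : ℕ} :
      a.eval σ ≠ Data.nil → Runs p σ σ' t → Runs (ite a p q) σ σ' (a.cost + 1 + t)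
  | ite_false {a : Term} {p q : Program} {σ σ' : Store} {t : ℕ} :
      a.eval σ = Data.nil → Runs q σ σ' t → Runs (ite a p q) σ σ' (a.cost + 1 + t)
  | loop_true {a : Term} {p : Program} {σ σ' σ'' : Store} {t t' : ℕ} :
      a.eval σ ≠ Data.nil → Runs p σ σ' t → Runs (loop a p) σ' σ'' t' →
        Runs (loop a p) σ σ'' (a.cost + 1 + t + t')
  | loop_false {a : Term} {p : Program} {σ : Store} :
      a.eval σ = Data.nil → Runs (loop a p) σ σ (a.cost + 1)

/-- The initial store: the input is in variable `0`, all other variables hold `nil`. -/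
def initStore (x : Data) : Store :=
  Function.update (fun _ => Data.nil) 0 x

/-- On the input `x` the program halts after exactly `t` steps, with the output `y` in
variable `0`. -/
def Program.Outputs (p : Program) (x y : Data) (t : ℕ) : Prop :=
  ∃ σ : Store, p.Runs (initStore x) σ t ∧ σ 0 = y

/-! ### Encoding of instances and solutions -/

/-- Truth values: `false` is a leaf, `true` is a cell with two leaves. -/
def Data.ofBool : Bool → Data
  | false => nil
  | true => cons nil nil

/-- Lists, as chains of cells that end in a leaf. -/
def Data.ofList : List Data → Data
  | [] => nil
  | x :: l => cons x (ofList l)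

/-- The list of the values of a truth-valued function on `{0, …, n - 1}`. -/
def Data.ofVector {n : ℕ} (f : Fin n → Bool) : Data :=
  ofList (List.ofFn fun i => ofBool (f i))

/-- A matrix of truth values, as the list of its rows. -/
def Data.ofMatrix {m n : ℕ} (f : Fin m → Fin n → Bool) : Data :=
  ofList (List.ofFn fun i => ofVector (f i))

/-- An instance: the adjacency matrix of the graph, the adjacency matrix of the tree of the
decomposition, and the list of the bags, each as the characteristic vector of a set of
vertices. -/
def encodeInstance {n N : ℕ} (G : SimpleGraph (Fin n)) [DecidableRel G.Adj]
    (D : TreeDecomposition G (Fin N)) [DecidableRel D.tree.Adj] : Data :=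
  Data.cons (Data.ofMatrix fun u v => decide (G.Adj u v))
    (Data.cons (Data.ofMatrix fun s t => decide (D.tree.Adj s t))
      (Data.ofMatrix fun t v => decide (v ∈ D.bag t)))

end MinStableCut

/-! ### Polynomial-time functions -/

namespace MinStableCut

/-! The algorithm is dynamic programming by exchange. A table pairs a vertex set A with a list of
cuts such that every stable cut can be overwritten on A by a listed cut while staying stable and
keeping its weight (`Represents`). The rest of the graph sees a cut of A only through the stability
of the interior vertices of A, the number of cut edges inside A, and, for each boundary vertex, its
side and its number of cut edges into A. Cuts that agree in these data can replace each other
(`Interchangeable.isStable`, `Interchangeable.cutWeight_eq`), so one per class suffices, and a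
boundary of b vertices leaves at most (2(Δ+1))^b · 2(n²+1) of them (`length_prune_le`). Overwriting
on two sets in turn yields a table for their union (`Represents.merge`), whatever the sets are; the
tree decomposition serves only to keep boundaries small.

The tables of the bags are built from single vertices. Then a leaf of the tree of tables is merged
into its neighbor until one table remains. The boundary of a group of merged nodes lies in the bag
of its representative (`IsGrouping.mem_bag`), so b ≤ tw + 1 throughout. The last table covers all
vertices, hence contains an optimal cut (`best_spec`); stable cuts exist because a maximum cut is
stable (`exists_isStable`).

For Δ ≥ 2 the inequality 2(Δ+1) ≤ Δ³ turns the bound into Δ^(3 tw) times a polynomial. For Δ ≤ 1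
nothing exponential in tw is allowed, but then a stable cut is exactly a cut of all edges, and one
is written down directly (`represents_matchingCut`).

The program comes from closure properties of polynomial-time functions. A fold is harmless only if
its intermediate values stay small (`PolyTime.foldl`), and the tables are not polynomial in the
input. So the input carries a budget that counts towards its size but is invisible to the program
(`BudgetedInput`, `exists_program`). -/

/-- Types whose elements are encoded as binary trees and have a size. The size need not be that of
the tree: a type may carry a budget for the computations on its elements. -/
class Enc (α : Type) where
  enc : α → Data
  sz : α → ℕ

open Enc

/-- Functions that are bounded by a polynomial in the size of the argument. -/
def PolyBdd {α : Type} [Enc α] (u : α → ℕ) : Prop :=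
  ∃ c, ∀ a, u a ≤ (sz a + 2) ^ c

section PolyBdd

variable {α : Type} [Enc α] {u v : α → ℕ}

theorem PolyBdd.mono (hv : PolyBdd v) (h : ∀ a, u a ≤ v a) : PolyBdd u :=
  let ⟨c, hc⟩ := hv
  ⟨c, fun a => (h a).trans (hc a)⟩

theorem PolyBdd.size : PolyBdd (fun a : α => sz a) := ⟨1, fun a => by simp⟩

theorem PolyBdd.const (k : ℕ) : PolyBdd (fun _ : α => k) :=
  ⟨k, fun a => Nat.lt_two_pow_self.le.trans (Nat.pow_le_pow_left (by omega) k)⟩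

theorem PolyBdd.mul (hu : PolyBdd u) (hv : PolyBdd v) : PolyBdd (fun a => u a * v a) := by
  obtain ⟨c, hc⟩ := hu
  obtain ⟨d, hd⟩ := hv
  exact ⟨c + d, fun a => by rw [pow_add]; exact Nat.mul_le_mul (hc a) (hd a)⟩

theorem PolyBdd.add (hu : PolyBdd u) (hv : PolyBdd v) : PolyBdd (fun a => u a + v a) := by
  obtain ⟨c, hc⟩ := hu
  obtain ⟨d, hd⟩ := hv
  refine ⟨c + d + 1, fun a => ?_⟩
  have h1 : u a ≤ (sz a + 2) ^ (c + d) :=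
    (hc a).trans (Nat.pow_le_pow_right (by omega) (by omega))
  have h2 : v a ≤ (sz a + 2) ^ (c + d) :=
    (hd a).trans (Nat.pow_le_pow_right (by omega) (by omega))
  calc u a + v a ≤ (sz a + 2) ^ (c + d) * 2 := by omega
    _ ≤ (sz a + 2) ^ (c + d) * (sz a + 2) := Nat.mul_le_mul_left _ (by omega)
    _ = (sz a + 2) ^ (c + d + 1) := (pow_succ _ _).symm

theorem PolyBdd.pow (hu : PolyBdd u) (k : ℕ) : PolyBdd (fun a => u a ^ k) := by
  obtain ⟨c, hc⟩ := hu
  exact ⟨c * k, fun a => by rw [pow_mul]; exact Nat.pow_le_pow_left (hc a) k⟩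

theorem PolyBdd.comp {β : Type} [Enc β] {w : β → ℕ} {f : α → β} (hw : PolyBdd w)
    (hf : PolyBdd fun a => sz (f a)) : PolyBdd (fun a => w (f a)) := by
  obtain ⟨c, hc⟩ := hw
  exact ((hf.add (.const 2)).pow c).mono fun a => hc (f a)

end PolyBdd

/-- The program `p` computes `f` in time `T`, with argument and value in variable `0`, and leaves
variable `1` as it was; this variable is used as a stack. -/
def Program.Computes {α β : Type} [Enc α] [Enc β] (p : Program) (f : α → β) (T : α → ℕ) : Prop :=
  ∀ (a : α) (σ : Store), σ 0 = enc a →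
    ∃ (σ' : Store) (t : ℕ), p.Runs σ σ' t ∧ σ' 0 = enc (f a) ∧ σ' 1 = σ 1 ∧ t ≤ T a

/-- Functions that are computed in polynomial time and have values of polynomial size. -/
@[fun_prop]
def PolyTime {α β : Type} [Enc α] [Enc β] (f : α → β) : Prop :=
  PolyBdd (fun a => sz (f a)) ∧ ∃ (p : Program) (T : α → ℕ), PolyBdd T ∧ p.Computes f T

/-! ### Composition, pairs and case distinction in polynomial time -/

section Basic

variable {α β γ δ : Type} [Enc α] [Enc β] [Enc γ] [Enc δ]

theorem PolyTime.of_term {f : α → β} (e : Term)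
    (he : ∀ a (σ : Store), σ 0 = enc a → e.eval σ = enc (f a))
    (hf : PolyBdd fun a => sz (f a)) : PolyTime f :=
  ⟨hf, .assign 0 e, fun _ => e.cost + 1, .const _, fun a σ h =>
    ⟨_, _, .assign 0 e σ, by simp [he a σ h], by simp, le_rfl⟩⟩

theorem PolyTime.congr {f g : α → β} (hf : PolyTime f) (h : ∀ a, f a = g a) : PolyTime g :=
  (funext h : f = g) ▸ hf

@[fun_prop]
theorem PolyTime.id : PolyTime (fun a : α => a) :=
  .of_term (.var 0) (fun _ _ h => h) .size

@[fun_prop]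
theorem PolyTime.const (b : β) : PolyTime (fun _ : α => b) := by
  have key : ∀ d : Data, ∃ e : Term, ∀ σ, e.eval σ = d := by
    intro d
    induction d with
    | nil => exact ⟨.nil, fun _ => rfl⟩
    | cons l r hl hr =>
      obtain ⟨e, he⟩ := hl
      obtain ⟨e', he'⟩ := hr
      exact ⟨.cons e e', fun σ => by simp [Term.eval, he, he']⟩
  obtain ⟨e, he⟩ := key (enc b)
  exact .of_term e (fun _ σ _ => he σ) (.const _)

theorem PolyTime.size_le {f : α → β} (hf : PolyTime f) : PolyBdd (fun a => sz (f a)) := hf.1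

@[fun_prop]
theorem PolyTime.comp {g : β → γ} {f : α → β} (hg : PolyTime g) (hf : PolyTime f) :
    PolyTime (fun a => g (f a)) := by
  obtain ⟨hfs, p, T, hT, hp⟩ := hf
  obtain ⟨hgs, q, T', hT', hq⟩ := hg
  refine ⟨hgs.comp hfs, .seq p q, fun a => T a + T' (f a), hT.add (hT'.comp hfs), fun a σ h => ?_⟩
  obtain ⟨σ', t, h1, h2, h3, h4⟩ := hp a σ h
  obtain ⟨σ'', t', k1, k2, k3, k4⟩ := hq (f a) σ' h2
  exact ⟨σ'', _, .seq h1 k1, k2, k3.trans h3, Nat.add_le_add h4 k4⟩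

instance : Enc (α × β) where
  enc x := .cons (enc x.1) (enc x.2)
  sz x := sz x.1 + sz x.2 + 1

theorem enc_prod (x : α × β) : enc x = .cons (enc x.1) (enc x.2) := rfl

theorem sz_prod (x : α × β) : sz x = sz x.1 + sz x.2 + 1 := rfl

@[fun_prop]
theorem PolyTime.prodMk {f : α → β} {g : α → γ} (hf : PolyTime f) (hg : PolyTime g) :
    PolyTime (fun a => (f a, g a)) := by
  obtain ⟨hfs, p, T, hT, hp⟩ := hf
  obtain ⟨hgs, q, T', hT', hq⟩ := hg
  -- Called programs may destroy every variable except the stack, so the argument waits on the stack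
  -- during `p`, and the first result during `q`; variable 2 is used only between calls.
  let push : Program := .assign 1 (.cons (.var 0) (.var 1))
  let swap1 : Program := .assign 2 (.hd (.var 1))
  let swap2 : Program := .assign 1 (.cons (.var 0) (.tl (.var 1)))
  let swap3 : Program := .assign 0 (.var 2)
  let pop1 : Program := .assign 0 (.cons (.hd (.var 1)) (.var 0))
  let pop2 : Program := .assign 1 (.tl (.var 1))
  refine ⟨((hfs.add hgs).add (.const 1)),
    .seq push (.seq p (.seq swap1 (.seq swap2 (.seq swap3 (.seq q (.seq pop1 pop2)))))),
    fun a => T a + T' a + 30, (hT.add hT').add (.const 30), fun a σ h => ?_⟩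
  obtain ⟨σ₁, t₁, h1, h2, h3, h4⟩ := hp a (Function.update σ 1 (.cons (σ 0) (σ 1))) (by simpa)
  obtain ⟨σ₂, t₂, k1, k2, k3, k4⟩ := hq a (Function.update (Function.update (Function.update σ₁ 2
    (σ 0)) 1 (.cons (σ₁ 0) (σ 1))) 0 (σ 0)) (by simpa)
  -- Unification determines the store in which `q` starts; that it is the predicted one is checked
  -- afterwards by `convert`.
  refine ⟨_, _, .seq (.assign _ _ _) (.seq h1 (.seq (.assign _ _ _) (.seq (.assign _ _ _)
    (.seq (.assign _ _ _) (.seq (?_ : Program.Runs _ _ σ₂ t₂)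
    (.seq (.assign _ _ _) (.assign _ _ _))))))), ?_, ?_, ?_⟩
  · convert k1 using 1
    simp [Term.eval, h3, Data.hd, Data.tl]
  · simp [Term.eval, k2, k3, h2, Data.hd, enc_prod]
  · simp [Term.eval, k3, Data.tl]
  · simp only [Term.cost]
    omega

theorem PolyTime.fst : PolyTime (Prod.fst : α × β → α) :=
  .of_term (.hd (.var 0)) (fun a σ h => by simp [Term.eval, h, enc_prod, Data.hd])
    (PolyBdd.size.mono fun a => by rw [sz_prod]; omega)

theorem PolyTime.snd : PolyTime (Prod.snd : α × β → β) :=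
  .of_term (.tl (.var 0)) (fun a σ h => by simp [Term.eval, h, enc_prod, Data.tl])
    (PolyBdd.size.mono fun a => by rw [sz_prod]; omega)

@[fun_prop]
theorem PolyTime.fst' {f : α → β × γ} (hf : PolyTime f) : PolyTime (fun a => (f a).1) :=
  PolyTime.fst.comp hf

@[fun_prop]
theorem PolyTime.snd' {f : α → β × γ} (hf : PolyTime f) : PolyTime (fun a => (f a).2) :=
  PolyTime.snd.comp hf

instance : Enc Bool where
  enc := Data.ofBool
  sz _ := 1

theorem enc_bool (b : Bool) : enc b = Data.ofBool b := rfl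

@[fun_prop]
theorem PolyTime.cond {c : α → Bool} {f g : α → β} (hc : PolyTime c) (hf : PolyTime f)
    (hg : PolyTime g) : PolyTime (fun a => cond (c a) (f a) (g a)) := by
  obtain ⟨-, r, T₀, hT₀, hr⟩ := hc
  obtain ⟨hfs, p, T, hT, hp⟩ := hf
  obtain ⟨hgs, q, T', hT', hq⟩ := hg
  let push : Program := .assign 1 (.cons (.var 0) (.var 1))
  let swap1 : Program := .assign 2 (.var 0)
  let swap2 : Program := .assign 0 (.hd (.var 1))
  let swap3 : Program := .assign 1 (.tl (.var 1))
  refine ⟨(hfs.add hgs).mono fun a => by cases hca : c a <;> simp [hca],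
    .seq push (.seq r (.seq swap1 (.seq swap2 (.seq swap3 (.ite (.var 2) p q))))),
    fun a => T₀ a + (T a + T' a) + 30, (hT₀.add (hT.add hT')).add (.const 30), fun a σ h => ?_⟩
  obtain ⟨σ₁, t₁, h1, h2, h3, h4⟩ := hr a (Function.update σ 1 (.cons (σ 0) (σ 1))) (by simpa)
  let σ₂ : Store := Function.update (Function.update (Function.update σ₁ 2 (σ₁ 0)) 0 (σ 0)) 1 (σ 1)
  have key : ∃ (σ' : Store) (t : ℕ), (Program.ite (.var 2) p q).Runs σ₂ σ' t ∧
      σ' 0 = enc (bif c a then f a else g a) ∧ σ' 1 = σ 1 ∧ t ≤ T a + T' a + 2 := by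
    cases hca : c a with
    | false =>
      obtain ⟨σ₃, t₂, k1, k2, k3, k4⟩ := hq a σ₂ (by simpa [σ₂])
      refine ⟨σ₃, _, .ite_false ?_ k1, k2, ?_, ?_⟩
      · simp [Term.eval, σ₂, h2, hca, enc_bool, Data.ofBool]
      · simp [k3, σ₂]
      · simp only [Term.cost]; omega
    | true =>
      obtain ⟨σ₃, t₂, k1, k2, k3, k4⟩ := hp a σ₂ (by simpa [σ₂])
      refine ⟨σ₃, _, .ite_true ?_ k1, k2, ?_, ?_⟩
      · simp [Term.eval, σ₂, h2, hca, enc_bool, Data.ofBool]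
      · simp [k3, σ₂]
      · simp only [Term.cost]; omega
  obtain ⟨σ', t, k1, k2, k3, k4⟩ := key
  refine ⟨σ', _, .seq (.assign _ _ _) (.seq h1 (.seq (.assign _ _ _) (.seq (.assign _ _ _)
    (.seq (.assign _ _ _) (?_ : Program.Runs _ _ _ t))))), ?_, k3, ?_⟩
  · convert k1 using 1
    simp [Term.eval, h3, Data.hd, Data.tl, σ₂]
  · exact k2
  · simp only [Term.cost]; omega

end Basic

/-! ### Encoding of lists, and folds as loops -/

section Lists

variable {α β γ δ : Type} [Enc α] [Enc β] [Enc γ] [Enc δ]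

instance : Enc (List β) where
  enc l := Data.ofList (l.map enc)
  sz l := (l.map fun b => sz b + 1).sum + 1

theorem enc_nil : enc ([] : List β) = .nil := rfl

theorem enc_cons (b : β) (l : List β) : enc (b :: l) = .cons (enc b) (enc l) := rfl

theorem sz_nil : sz ([] : List β) = 1 := rfl

theorem sz_cons (b : β) (l : List β) : sz (b :: l) = sz b + 1 + sz l := by
  simp [sz, add_assoc]

theorem sz_append (l l' : List β) : sz (l ++ l') + 1 = sz l + sz l' := by
  simp [sz]; omega

theorem length_lt_sz (l : List β) : l.length < sz l := by
  induction l with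
  | nil => simp [sz_nil]
  | cons b l ih => rw [sz_cons, List.length_cons]; omega

theorem sz_le_of_mem {l : List β} {b : β} (h : b ∈ l) : sz b ≤ sz l := by
  induction l with
  | nil => simp at h
  | cons b' l ih =>
    rw [sz_cons]
    rcases List.mem_cons.1 h with rfl | h
    · omega
    · have := ih h; omega

theorem sz_le_of_sublist {l l' : List β} (h : l.Sublist l') : sz l ≤ sz l' := by
  induction h with
  | slnil => exact le_rfl
  | cons b _ ih => rw [sz_cons]; omega
  | cons_cons b _ ih => rw [sz_cons, sz_cons]; omega

theorem sz_le_mul (l : List β) (k : ℕ) (h : ∀ b ∈ l, sz b ≤ k) : sz l ≤ l.length * (k + 1) + 1 := by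
  induction l with
  | nil => simp [sz_nil]
  | cons b l ih =>
    have h1 := ih fun b' hb' => h b' (List.mem_cons_of_mem _ hb')
    have h2 := h b List.mem_cons_self
    rw [sz_cons, List.length_cons, Nat.add_mul]
    omega

/-- A step that is polynomial in its own argument could still double the accumulator each time, so
polynomial size of all partial results has to be assumed. Given that, every iteration costs a
polynomial in the size of `a`, uniformly. -/
theorem PolyTime.foldl_of_bdd {f : α → List β} {g : α → γ} {h : α → γ → β → γ}
    (hf : PolyTime f) (hg : PolyTime g)
    (hh : PolyTime fun q : α × γ × β => h q.1 q.2.1 q.2.2)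
    (hs : PolyBdd fun a => (Finset.range ((f a).length + 1)).sup fun k =>
      sz (((f a).take k).foldl (h a) (g a))) :
    PolyTime (fun a => (f a).foldl (h a) (g a)) := by
  set U : α → ℕ := fun a => (Finset.range ((f a).length + 1)).sup fun k =>
      sz (((f a).take k).foldl (h a) (g a)) with hU
  have hUle : ∀ a k, sz (((f a).take k).foldl (h a) (g a)) ≤ U a := by
    intro a k
    rcases le_or_gt k (f a).length with hk | hk
    · exact Finset.le_sup (f := fun k => sz (((f a).take k).foldl (h a) (g a)))
        (Finset.mem_range.2 (by omega))
    · have := Finset.le_sup (f := fun k => sz (((f a).take k).foldl (h a) (g a)))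
        (Finset.mem_range.2 (Nat.lt_succ_self (f a).length))
      rw [List.take_length] at this
      rw [List.take_of_length_le hk.le]
      exact this
  have hsz : PolyBdd fun a => sz ((f a).foldl (h a) (g a)) := hs.mono fun a => by
    simpa using hUle a (f a).length
  obtain ⟨hfs, p, T, hT, hp⟩ := (hf.prodMk hg).prodMk PolyTime.id
  obtain ⟨-, q, T', ⟨c, hc⟩, hq⟩ := hh
  -- Between iterations variable 0 holds the remaining list, the accumulator and the argument. The
  -- tail of the list and the argument go on the stack while `q` runs on the triple built by `call`.
  let load : Program := .assign 1 (.cons (.cons (.tl (.hd (.var 0))) (.tl (.tl (.var 0)))) (.var 1))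
  let call : Program := .assign 0 (.cons (.tl (.tl (.var 0))) (.cons (.hd (.tl (.var 0)))
    (.hd (.hd (.var 0)))))
  let store : Program := .assign 0 (.cons (.hd (.hd (.var 1))) (.cons (.var 0)
    (.tl (.hd (.var 1)))))
  let drop : Program := .assign 1 (.tl (.var 1))
  let start : Program := .assign 0 (.cons (.hd (.hd (.var 0))) (.cons (.tl (.hd (.var 0)))
    (.tl (.var 0))))
  let body : Program := .seq load (.seq call (.seq q (.seq store drop)))
  have main : ∀ (a : α) (K : ℕ) (l : List β) (acc : γ)
      (hK : ∀ k b, l[k]? = some b → T' (a, (l.take k).foldl (h a) acc, b) ≤ K) (σ : Store),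
      σ 0 = .cons (enc l) (.cons (enc acc) (enc a)) →
      ∃ (σ' : Store) (t : ℕ), (Program.loop (.hd (.var 0)) body).Runs σ σ' t ∧
        σ' 0 = .cons .nil (.cons (enc (l.foldl (h a) acc)) (enc a)) ∧
        σ' 1 = σ 1 ∧ t ≤ (l.length + 1) * (K + 60) := by
    intro a K l
    induction l with
    | nil =>
      intro acc _ σ hσ
      refine ⟨σ, _, .loop_false ?_, hσ, rfl, ?_⟩
      · simp [Term.eval, hσ, Data.hd, enc_nil]
      · simp [Term.cost]
    | cons b l ih =>
      intro acc hK σ hσ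
      obtain ⟨σ₁, t₁, h1, h2, h3, h4⟩ := hq (a, acc, b) (Function.update (Function.update σ 1
        (.cons (.cons (enc l) (enc a)) (σ 1))) 0 (enc (a, acc, b))) (by simp)
      have h4' : t₁ ≤ K := h4.trans (by simpa using hK 0 b (by simp))
      obtain ⟨σ₂, t₂, k1, k2, k3, k4⟩ := ih (h a acc b)
        (fun k b' hb' => by simpa using hK (k + 1) b' (by simpa using hb'))
        (Function.update (Function.update σ₁ 0 (.cons (enc l) (.cons (enc (h a acc b)) (enc a)))) 1
          (σ 1)) (by simp)
      refine ⟨σ₂, _, .loop_true ?_ (.seq (.assign _ _ _) (.seq (.assign _ _ _)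
        (.seq (?_ : Program.Runs _ _ σ₁ t₁) (.seq (.assign _ _ _) (.assign _ _ _)))))
        (?_ : Program.Runs _ _ _ t₂), by simpa using k2, by simp [k3], ?_⟩
      · simp [Term.eval, hσ, Data.hd, enc_cons]
      · convert h1 using 1
        simp [Term.eval, hσ, Data.hd, Data.tl, enc_cons, enc_prod]
      · convert k1 using 1
        simp [Term.eval, h3, h2, Data.hd, Data.tl]
      · simp only [Term.cost, List.length_cons]
        have : (l.length + 1 + 1) * (K + 60) = (l.length + 1) * (K + 60) + (K + 60) := by ring
        omega
  refine ⟨hsz, .seq p (.seq start (.seq (.loop (.hd (.var 0)) body)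
    (.assign 0 (.hd (.tl (.var 0)))))), fun a => T a +
      ((sz (f a) + 1) * ((sz a + U a + sz (f a) + 4) ^ c + 60)) + 30, ?_, fun a σ hσ => ?_⟩
  · exact (hT.add ((hf.size_le.add (.const 1)).mul
      ((((PolyBdd.size.add hs).add hf.size_le).add (.const 4)).pow c |>.add (.const 60)))).add
      (.const 30)
  · obtain ⟨σ₁, t₁, h1, h2, h3, h4⟩ := hp a σ hσ
    -- The 4 is made of the two pair constructors of the triple and the offset 2 of `PolyBdd`.
    obtain ⟨σ₂, t₂, k1, k2, k3, k4⟩ := main a ((sz a + U a + sz (f a) + 4) ^ c) (f a) (g a)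
      (fun k b hb => (hc _).trans (Nat.pow_le_pow_left (by
        have := sz_le_of_mem (List.mem_of_getElem? hb)
        have := hUle a k
        simp only [sz_prod]
        omega) c))
      (Function.update σ₁ 0 (.cons (enc (f a)) (.cons (enc (g a)) (enc a)))) (by simp)
    refine ⟨_, _, .seq h1 (.seq (.assign _ _ _) (.seq (?_ : Program.Runs _ _ σ₂ t₂)
      (.assign _ _ _))), ?_, ?_, ?_⟩
    · convert k1 using 1
      simp [Term.eval, h2, Data.hd, Data.tl, enc_prod]
    · simp [Term.eval, k2, Data.hd, Data.tl]
    · simp [k3, h3]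
    · have : ((f a).length + 1) * ((sz a + U a + sz (f a) + 4) ^ c + 60) ≤
          (sz (f a) + 1) * ((sz a + U a + sz (f a) + 4) ^ c + 60) :=
        Nat.mul_le_mul_right _ (by have := length_lt_sz (f a); omega)
      simp only [Term.cost]
      omega

theorem PolyTime.foldl {f : α → List β} {g : α → γ} {h : α → γ → β → γ}
    (hf : PolyTime f) (hg : PolyTime g)
    (hh : PolyTime fun q : α × γ × β => h q.1 q.2.1 q.2.2) {U : α → ℕ} (hU : PolyBdd U)
    (hs : ∀ a k, sz (((f a).take k).foldl (h a) (g a)) ≤ U a) :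
    PolyTime (fun a => (f a).foldl (h a) (g a)) :=
  .foldl_of_bdd hf hg hh (hU.mono fun a => Finset.sup_le fun k _ => hs a k)

end Lists
end MinStableCut

/-! ### A library of polynomial-time functions -/

namespace MinStableCut

open Enc

section Lists

variable {α β γ δ : Type} [Enc α] [Enc β] [Enc γ] [Enc δ]

@[fun_prop]
theorem PolyTime.list_cons {f : α → β} {g : α → List β} (hf : PolyTime f) (hg : PolyTime g) :
    PolyTime (fun a => f a :: g a) := by
  have : PolyTime (fun q : β × List β => q.1 :: q.2) :=
    .of_term (.var 0) (fun _ _ h => h)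
      (PolyBdd.size.mono fun q => by rw [sz_cons, sz_prod]; omega)
  exact this.comp (hf.prodMk hg)

@[fun_prop]
theorem PolyTime.tail {f : α → List β} (hf : PolyTime f) : PolyTime (fun a => (f a).tail) := by
  have : PolyTime (fun l : List β => l.tail) :=
    .of_term (.tl (.var 0))
      (fun l _ h => by cases l <;> simp [Term.eval, h, enc_nil, enc_cons, Data.tl])
      (PolyBdd.size.mono fun l => sz_le_of_sublist l.tail_sublist)
  exact this.comp hf

@[fun_prop]
theorem PolyTime.foldl_bool {f : α → List β} {g : α → Bool} {h : α → Bool → β → Bool}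
    (hf : PolyTime f) (hg : PolyTime g)
    (hh : PolyTime fun q : α × Bool × β => h q.1 q.2.1 q.2.2) :
    PolyTime (fun a => (f a).foldl (h a) (g a)) :=
  hf.foldl hg hh (.const 1) fun _ _ => le_rfl

@[fun_prop]
theorem PolyTime.not {f : α → Bool} (hf : PolyTime f) : PolyTime (fun a => !f a) := by
  have := hf.cond (PolyTime.const false) (PolyTime.const true)
  exact this.congr fun a => by cases h : f a <;> simp

@[fun_prop]
theorem PolyTime.and {f g : α → Bool} (hf : PolyTime f) (hg : PolyTime g) :
    PolyTime (fun a => f a && g a) := by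
  have := hf.cond hg (PolyTime.const false)
  exact this.congr fun a => by cases h : f a <;> simp

@[fun_prop]
theorem PolyTime.or {f g : α → Bool} (hf : PolyTime f) (hg : PolyTime g) :
    PolyTime (fun a => f a || g a) := by
  have := hf.cond (PolyTime.const true) hg
  exact this.congr fun a => by cases h : f a <;> simp

@[fun_prop]
theorem PolyTime.xor {f g : α → Bool} (hf : PolyTime f) (hg : PolyTime g) :
    PolyTime (fun a => Bool.xor (f a) (g a)) := by
  have := hf.cond hg.not hg
  exact this.congr fun a => by cases h : f a <;> simp

@[fun_prop]
theorem PolyTime.all {f : α → List β} {g : α → β → Bool} (hf : PolyTime f)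
    (hg : PolyTime fun q : α × β => g q.1 q.2) : PolyTime (fun a => (f a).all (g a)) := by
  have key : ∀ (l : List β) (p : β → Bool) (b : Bool),
      l.foldl (fun acc x => acc && p x) b = (b && l.all p) := by
    intro l p
    induction l with
    | nil => simp
    | cons x l ih => intro b; simp only [List.foldl_cons, ih, List.all_cons, Bool.and_assoc]
  have : PolyTime (fun a => (f a).foldl (fun acc x => acc && g a x) true) :=
    .foldl_bool hf (.const _) (.and (by fun_prop)
      (hg.comp (f := fun q : α × Bool × β => (q.1, q.2.2)) (by fun_prop)))
  simpa [key] using this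

@[fun_prop]
theorem PolyTime.any {f : α → List β} {g : α → β → Bool} (hf : PolyTime f)
    (hg : PolyTime fun q : α × β => g q.1 q.2) : PolyTime (fun a => (f a).any (g a)) := by
  have : PolyTime (fun a => !(f a).all fun b => !g a b) := by fun_prop
  simpa [List.not_all_eq_any_not] using this

@[fun_prop]
theorem PolyTime.isEmpty {f : α → List β} (hf : PolyTime f) :
    PolyTime (fun a => (f a).isEmpty) := by
  have : PolyTime (fun a => (f a).all fun _ => false) := by fun_prop
  exact this.congr fun a => by cases f a <;> simp

@[fun_prop]
-- The head of `nil` is `nil` on the machine, so an empty list is first replaced by the list of the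
-- default value.
theorem PolyTime.headD {f : α → List β} {g : α → β} (hf : PolyTime f) (hg : PolyTime g) :
    PolyTime (fun a => (f a).headD (g a)) := by
  have h1 : PolyTime (fun q : β × List β => bif q.2.isEmpty then [q.1] else q.2) := by fun_prop
  obtain ⟨-, p, T, hT, hp⟩ := h1
  have : PolyTime (fun q : β × List β => q.2.headD q.1) := by
    refine ⟨PolyBdd.size.mono fun q => ?_, .seq p (.assign 0 (.hd (.var 0))), fun q => T q + 3,
      hT.add (.const 3), fun q σ h => ?_⟩
    · rw [sz_prod]
      rcases q with ⟨d, _ | ⟨b, l⟩⟩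
      · simp; omega
      · simp [sz_cons]; omega
    · obtain ⟨σ', t, h1, h2, h3, h4⟩ := hp q σ h
      refine ⟨_, _, .seq h1 (.assign _ _ _), ?_, by simp [h3], by simp [Term.cost, h4]⟩
      rcases q with ⟨d, _ | ⟨b, l⟩⟩ <;> simp [Term.eval, h2, enc_cons, Data.hd]
  exact this.comp (hg.prodMk hf)

@[fun_prop]
theorem PolyTime.reverse {f : α → List β} (hf : PolyTime f) :
    PolyTime (fun a => (f a).reverse) := by
  have key : ∀ l : List β, l.foldl (fun acc b => b :: acc) [] = l.reverse := by simp
  have := hf.foldl (PolyTime.const ([] : List β)) (h := fun _ acc b => b :: acc) (by fun_prop)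
    hf.size_le fun a k => by
      rw [key]
      refine le_trans (le_of_eq ?_) (sz_le_of_sublist (List.take_sublist k (f a)))
      simp [sz]
  simpa [key] using this

theorem sz_list (l : List β) : sz l = (l.map fun b => sz b + 1).sum + 1 := rfl

@[fun_prop]
theorem PolyTime.map {f : α → List β} {g : α → β → γ} (hf : PolyTime f)
    (hg : PolyTime fun q : α × β => g q.1 q.2) : PolyTime (fun a => (f a).map (g a)) := by
  have key : ∀ (l : List β) (h : β → γ) (acc : List γ),
      l.foldl (fun acc b => h b :: acc) acc = (l.map h).reverse ++ acc := by
    intro l h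
    induction l with
    | nil => simp
    | cons b l ih => simp [ih]
  obtain ⟨c, hc⟩ := hg.size_le
  have := hf.foldl (PolyTime.const ([] : List γ)) (h := fun a acc b => g a b :: acc)
    (.list_cons (hg.comp (f := fun q : α × List γ × β => (q.1, q.2.2)) (by fun_prop))
      (by fun_prop))
    (U := fun a => sz (f a) * ((sz a + sz (f a) + 3) ^ c + 1) + 1)
    ((hf.size_le.mul ((((PolyBdd.size.add hf.size_le).add (.const 3)).pow c).add (.const 1))).add
      (.const 1)) fun a k => by
      rw [key]
      refine (sz_le_mul _ ((sz a + sz (f a) + 3) ^ c) fun x hx => ?_).trans ?_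
      · simp only [List.append_nil, List.mem_reverse, List.mem_map] at hx
        obtain ⟨b, hb, rfl⟩ := hx
        refine (hc (a, b)).trans (Nat.pow_le_pow_left ?_ c)
        have := sz_le_of_mem (List.mem_of_mem_take hb)
        simp only [sz_prod]
        omega
      · refine Nat.add_le_add_right (Nat.mul_le_mul_right _ ?_) _
        have := length_lt_sz (f a)
        simp
        omega
  simpa [key] using this.reverse

@[fun_prop]
theorem PolyTime.append {f g : α → List β} (hf : PolyTime f) (hg : PolyTime g) :
    PolyTime (fun a => f a ++ g a) := by
  have key : ∀ l acc : List β, l.foldl (fun acc b => b :: acc) acc = l.reverse ++ acc := by simp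
  have := hf.reverse.foldl hg (h := fun _ acc b => b :: acc) (by fun_prop)
    (hf.size_le.add hg.size_le) fun a k => by
      rw [key]
      have h1 := sz_append ((f a).reverse.take k).reverse (g a)
      have h2 := sz_le_of_sublist (List.take_sublist k (f a).reverse)
      have h3 : ∀ l : List β, sz l.reverse = sz l := fun l => by simp [sz_list]
      rw [h3] at h1 h2
      omega
  simpa [key] using this

@[fun_prop]
theorem PolyTime.flatten {f : α → List (List β)} (hf : PolyTime f) :
    PolyTime (fun a => (f a).flatten) := by
  have key : ∀ (l : List (List β)) (acc : List β),
      l.foldl (fun acc b => acc ++ b) acc = acc ++ l.flatten := by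
    intro l
    induction l with
    | nil => simp
    | cons b l ih => simp [ih]
  have hsz : ∀ l : List (List β), sz l.flatten ≤ sz l := by
    intro l
    induction l with
    | nil => simp [sz_nil]
    | cons b l ih =>
      have := sz_append b l.flatten
      rw [List.flatten_cons, sz_cons]
      omega
  have := hf.foldl (PolyTime.const ([] : List β)) (h := fun _ acc b => acc ++ b) (by fun_prop)
    hf.size_le fun a k => by
      rw [key]
      exact (hsz _).trans (sz_le_of_sublist (List.take_sublist k (f a)))
  simpa [key] using this

@[fun_prop]
theorem PolyTime.flatMap {f : α → List β} {g : α → β → List γ} (hf : PolyTime f)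
    (hg : PolyTime fun q : α × β => g q.1 q.2) : PolyTime (fun a => (f a).flatMap (g a)) := by
  have : PolyTime (fun a => ((f a).map (g a)).flatten) := (hf.map hg).flatten
  simpa [List.flatMap] using this

@[fun_prop]
theorem PolyTime.filter {f : α → List β} {g : α → β → Bool} (hf : PolyTime f)
    (hg : PolyTime fun q : α × β => g q.1 q.2) : PolyTime (fun a => (f a).filter (g a)) := by
  have key : ∀ (l : List β) (p : β → Bool), l.flatMap (fun b => bif p b then [b] else []) = l.filter p := by
    intro l p
    induction l with
    | nil => rfl
    | cons b l ih => cases h : p b <;> simp [h, ih]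
  have : PolyTime (fun a => (f a).flatMap fun b => bif g a b then [b] else []) := by fun_prop
  simpa [key] using this

end Lists

/-! ### Unary arithmetic -/

section Numbers

variable {α β γ δ : Type} [Enc α] [Enc β] [Enc γ] [Enc δ]

instance : Enc Unit where
  enc _ := .nil
  sz _ := 0

/-- Unary suffices, since only indices, degrees and edge counts occur; arithmetic becomes list
processing. -/
instance : Enc ℕ where
  enc k := enc (List.replicate k ())
  sz k := k + 1

theorem enc_nat (k : ℕ) : enc k = enc (List.replicate k ()) := rfl

theorem sz_nat (k : ℕ) : sz k = k + 1 := rfl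

@[fun_prop]
theorem PolyTime.replicate_unit {f : α → ℕ} (hf : PolyTime f) :
    PolyTime (fun a => List.replicate (f a) ()) := by
  have : PolyTime (fun k : ℕ => List.replicate k ()) :=
    .of_term (.var 0) (fun _ _ h => h) (PolyBdd.size.mono fun k => by simp [sz])
  exact this.comp hf

@[fun_prop]
theorem PolyTime.length {f : α → List β} (hf : PolyTime f) : PolyTime (fun a => (f a).length) := by
  have : PolyTime (fun l : List Unit => l.length) :=
    .of_term (.var 0) (fun l _ h => by
      rw [enc_nat, ← List.eq_replicate_of_mem (l := l) (a := ()) fun _ _ => rfl]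
      exact h) (PolyBdd.size.mono fun l => by simp [sz])
  have h2 : PolyTime (fun a => ((f a).map fun _ => ()).length) := this.comp (by fun_prop)
  simpa using h2

@[fun_prop]
theorem PolyTime.add {f g : α → ℕ} (hf : PolyTime f) (hg : PolyTime g) :
    PolyTime (fun a => f a + g a) := by
  have : PolyTime (fun a => (List.replicate (f a) () ++ List.replicate (g a) ()).length) := by
    fun_prop
  simpa using this

@[fun_prop]
theorem PolyTime.range {f : α → ℕ} (hf : PolyTime f) : PolyTime (fun a => List.range (f a)) := by
  have key : ∀ l : List Unit,
      l.foldl (fun (acc : List ℕ) _ => acc ++ [acc.length]) [] = List.range l.length := by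
    intro l
    induction l using List.reverseRecOn with
    | nil => rfl
    | append_singleton l x ih => simp [ih, List.range_succ]
  have := hf.replicate_unit.foldl (PolyTime.const ([] : List ℕ))
    (h := fun _ acc _ => acc ++ [acc.length]) (by fun_prop)
    ((hf.size_le.mul (hf.size_le.add (.const 1))).add (.const 1)) fun a k => by
      rw [key]
      refine (sz_le_mul _ (f a + 1) fun x hx => ?_).trans ?_
      · have := List.mem_range.1 hx
        simp at this
        rw [sz_nat]
        omega
      · rw [sz_nat]
        refine Nat.add_le_add_right (Nat.mul_le_mul_right _ ?_) _
        simp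
  simpa [key] using this

@[fun_prop]
theorem PolyTime.drop {f : α → ℕ} {g : α → List β} (hf : PolyTime f) (hg : PolyTime g) :
    PolyTime (fun a => (g a).drop (f a)) := by
  have key : ∀ (l : List Unit) (acc : List β),
      l.foldl (fun acc _ => acc.tail) acc = acc.drop l.length := by
    intro l
    induction l with
    | nil => simp
    | cons x l ih => intro acc; simp [ih]
  have := hf.replicate_unit.foldl hg (h := fun _ acc _ => acc.tail) (by fun_prop)
    hg.size_le fun a k => by
      rw [key]
      exact sz_le_of_sublist (List.drop_sublist _ _)
  simpa [key] using this

@[fun_prop]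
theorem PolyTime.getD {f : α → ℕ} {g : α → List β} {d : α → β} (hf : PolyTime f) (hg : PolyTime g)
    (hd : PolyTime d) : PolyTime (fun a => (g a).getD (f a) (d a)) := by
  have : PolyTime (fun a => ((g a).drop (f a)).headD (d a)) := by fun_prop
  refine this.congr fun a => ?_
  rw [List.getD_eq_getElem?_getD, List.headD_eq_head?_getD, List.head?_drop]

@[fun_prop]
theorem PolyTime.ble {f g : α → ℕ} (hf : PolyTime f) (hg : PolyTime g) :
    PolyTime (fun a => Nat.ble (f a) (g a)) := by
  have : PolyTime (fun a => ((List.replicate (f a) ()).drop (g a)).isEmpty) := by fun_prop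
  refine this.congr fun a => ?_
  rw [Bool.eq_iff_iff]
  simp [Nat.ble_eq, Nat.sub_eq_zero_iff_le]

@[fun_prop]
theorem PolyTime.beq {f g : α → ℕ} (hf : PolyTime f) (hg : PolyTime g) :
    PolyTime (fun a => Nat.beq (f a) (g a)) := by
  have : PolyTime (fun a => Nat.ble (f a) (g a) && Nat.ble (g a) (f a)) := by fun_prop
  refine this.congr fun a => ?_
  rw [Bool.eq_iff_iff]
  simp only [Bool.and_eq_true, Nat.ble_eq, Nat.beq_eq]
  exact le_antisymm_iff.symm

@[fun_prop]
theorem PolyTime.countP {f : α → List β} {g : α → β → Bool} (hf : PolyTime f)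
    (hg : PolyTime fun q : α × β => g q.1 q.2) : PolyTime (fun a => (f a).countP (g a)) := by
  have : PolyTime (fun a => ((f a).filter (g a)).length) := (hf.filter hg).length
  simpa [List.countP_eq_length_filter] using this

end Numbers
end MinStableCut

/-! ### The algorithm

Sets of vertices and cuts are lists of truth values. The algorithm works on pairs of a set `A` of
vertices and a list of cuts that represents all cuts as far as their restrictions to `A` are
concerned. Such a pair, together with a node of the tree, is a table. -/

namespace MinStableCut

open Enc

/-- The entry of a list of truth values; `false` outside of the list. -/
def bit (l : List Bool) (i : ℕ) : Bool := l.getD i false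

/-- The entry of a matrix of truth values. -/
def entry (M : List (List Bool)) (i j : ℕ) : Bool := bit (M.getD i []) j

/-- A node of the tree, a set of vertices and a list of cuts. -/
abbrev Table : Type := ℕ × List Bool × List (List Bool)

/-- The adjacency matrices of the graph and of the tree, and the bags. -/
abbrev Input : Type := List (List Bool) × List (List Bool) × List (List Bool)

def degreeAt (M : List (List Bool)) (v : ℕ) : ℕ :=
  (List.range M.length).countP fun u => entry M v u

/-- The number of cut edges between `v` and vertices of `A`. -/
def crossingsAt (M : List (List Bool)) (A p : List Bool) (v : ℕ) : ℕ :=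
  (List.range M.length).countP fun u => entry M v u && (bit A u && Bool.xor (bit p u) (bit p v))

/-- Whether `v` is a vertex of `A` with a neighbor outside of `A`. -/
def isBoundary (M : List (List Bool)) (A : List Bool) (v : ℕ) : Bool :=
  bit A v && (List.range M.length).any fun u => entry M v u && !bit A u

/-- Whether a cut is stable at the vertices of `A` that are not on the boundary. -/
def stableInside (M : List (List Bool)) (A p : List Bool) : Bool :=
  (List.range M.length).all fun v => (!bit A v || isBoundary M A v) ||
    Nat.ble (degreeAt M v) (crossingsAt M A p v + crossingsAt M A p v)

/-- Twice the number of cut edges inside of `A`. -/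
def weightInside (M : List (List Bool)) (A p : List Bool) : ℕ :=
  ((List.range M.length).flatMap fun v => (List.range M.length).filter fun u =>
    bit A v && (entry M v u && (bit A u && Bool.xor (bit p u) (bit p v)))).length

/-- Whether two cuts are interchangeable inside of `A`. -/
def interchangeable (M : List (List Bool)) (A p q : List Bool) : Bool :=
  (!Bool.xor (stableInside M A p) (stableInside M A q)) &&
    (Nat.beq (weightInside M A p) (weightInside M A q) &&
      (List.range M.length).all fun v => !isBoundary M A v ||
        ((!Bool.xor (bit p v) (bit q v)) && Nat.beq (crossingsAt M A p v) (crossingsAt M A q v)))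

/-- Keep one cut of every class of interchangeable cuts. -/
def prune (M : List (List Bool)) (A : List Bool) (L : List (List Bool)) : List (List Bool) :=
  L.foldl (fun acc p => bif acc.any (fun q => interchangeable M A q p) then acc else p :: acc) []

/-- The cut that agrees with `p` on `A` and with `q` elsewhere. -/
def override (M : List (List Bool)) (A p q : List Bool) : List Bool :=
  (List.range M.length).map fun v => bif bit A v then bit p v else bit q v

def union (M : List (List Bool)) (A B : List Bool) : List Bool :=
  (List.range M.length).map fun v => bit A v || bit B v

/-- The table of the union, with the node of the second table. -/
def merge (M : List (List Bool)) (x y : Table) : Table :=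
  (y.1, union M x.2.1 y.2.1, prune M (union M x.2.1 y.2.1)
    (x.2.2.flatMap fun p => y.2.2.map fun q => override M x.2.1 p q))

def constList (M : List (List Bool)) (b : Bool) : List Bool :=
  (List.range M.length).map fun _ => b

/-- The table of the set `{v}`. -/
def singleton (M : List (List Bool)) (v : ℕ) : Table :=
  (0, (List.range M.length).map fun u => Nat.beq u v, [constList M false, constList M true])

/-- Add the vertex `v` to the tables of the nodes whose bags contain it. -/
def introduce (M B : List (List Bool)) (l : List Table) (v : ℕ) : List Table :=
  l.map fun x => bif entry B x.1 v then merge M (singleton M v) x else x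

/-- Merge the table `x` into the table `y` of the list. -/
def contract (M : List (List Bool)) (l : List Table) (x y : Table) : List Table :=
  (l.filter fun z => !Nat.beq z.1 x.1).map fun z => bif Nat.beq z.1 y.1 then merge M x z else z

/-- The pairs of adjacent tables of which the first has no other neighbor. -/
def leaves (T : List (List Bool)) (l : List Table) : List (Table × Table) :=
  (l.flatMap fun x => l.map fun y => (x, y)).filter fun q => entry T q.1.1 q.2.1 &&
    Nat.ble (l.countP fun z => entry T q.1.1 z.1) 1

def contractLeaf (M T : List (List Bool)) (l : List Table) : List Table :=
  bif (leaves T l).isEmpty then l else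
    -- The default is never reached: the list of leaves is nonempty in this branch.
    contract M l ((leaves T l).headD default).1 ((leaves T l).headD default).2

/-- Whether all degrees are at most one. -/
def isMatching (M : List (List Bool)) : Bool :=
  (List.range M.length).all fun v => Nat.ble (degreeAt M v) 1

/-- A cut of all edges, if the degrees are at most one. -/
def matchingCut (M : List (List Bool)) : List Bool :=
  (List.range M.length).map fun v => (List.range M.length).any fun u =>
    (!Nat.ble v u) && entry M v u

/-- For degrees at most one the only table is complete from the start, and the later phases run over
empty lists; thus both cases share the same two folds. -/
def initialTables (x : Input) : List Table :=
  bif isMatching x.1 then [(0, constList x.1 true, [matchingCut x.1])] else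
    (List.range x.2.1.length).map fun t => (t, constList x.1 false, [constList x.1 false])

def introducedVertices (x : Input) : List ℕ :=
  bif isMatching x.1 then [] else List.range x.1.length

/-- The tables of the bags. -/
def bagTables (x : Input) : List Table :=
  (introducedVertices x).foldl (introduce x.1 x.2.2) (initialTables x)

def rounds (x : Input) : List ℕ :=
  bif isMatching x.1 then [] else List.range x.2.1.length

def contractAll (x : Input) : List Table :=
  (rounds x).foldl (fun l _ => contractLeaf x.1 x.2.1 l) (bagTables x)

/-- A stable cut of minimum weight among the stable cuts of a table. -/
def best (M : List (List Bool)) (x : Table) : List Bool :=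
  (x.2.2.filter fun p => stableInside M x.2.1 p && x.2.2.all fun q =>
    !stableInside M x.2.1 q || Nat.ble (weightInside M x.2.1 p) (weightInside M x.2.1 q)).headD []

def solve (x : Input) : List Bool :=
  best x.1 ((contractAll x).headD default)

section PolyTime

variable {α : Type} [Enc α] {M T B : α → List (List Bool)} {A p q : α → List Bool} {v : α → ℕ}

@[fun_prop]
theorem PolyTime.bit (hA : PolyTime A) (hv : PolyTime v) : PolyTime fun a => bit (A a) (v a) := by
  unfold MinStableCut.bit; fun_prop

@[fun_prop]
theorem PolyTime.entry {w : α → ℕ} (hM : PolyTime M) (hv : PolyTime v) (hw : PolyTime w) :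
    PolyTime fun a => entry (M a) (v a) (w a) := by
  unfold MinStableCut.entry; fun_prop

@[fun_prop]
theorem PolyTime.degreeAt (hM : PolyTime M) (hv : PolyTime v) :
    PolyTime fun a => degreeAt (M a) (v a) := by
  unfold MinStableCut.degreeAt; fun_prop

@[fun_prop]
theorem PolyTime.crossingsAt (hM : PolyTime M) (hA : PolyTime A) (hp : PolyTime p)
    (hv : PolyTime v) : PolyTime fun a => crossingsAt (M a) (A a) (p a) (v a) := by
  unfold MinStableCut.crossingsAt; fun_prop

@[fun_prop]
theorem PolyTime.isBoundary (hM : PolyTime M) (hA : PolyTime A) (hv : PolyTime v) :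
    PolyTime fun a => isBoundary (M a) (A a) (v a) := by
  unfold MinStableCut.isBoundary; fun_prop

@[fun_prop]
theorem PolyTime.stableInside (hM : PolyTime M) (hA : PolyTime A) (hp : PolyTime p) :
    PolyTime fun a => stableInside (M a) (A a) (p a) := by
  unfold MinStableCut.stableInside; fun_prop

@[fun_prop]
theorem PolyTime.weightInside (hM : PolyTime M) (hA : PolyTime A) (hp : PolyTime p) :
    PolyTime fun a => weightInside (M a) (A a) (p a) := by
  unfold MinStableCut.weightInside; fun_prop

@[fun_prop]
theorem PolyTime.interchangeable (hM : PolyTime M) (hA : PolyTime A) (hp : PolyTime p)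
    (hq : PolyTime q) : PolyTime fun a => interchangeable (M a) (A a) (p a) (q a) := by
  unfold MinStableCut.interchangeable; fun_prop

/-- The fold prepends the cuts that it keeps, hence the reversal. -/
theorem prune_sublist (M : List (List Bool)) (A : List Bool) (L : List (List Bool)) :
    (prune M A L).reverse.Sublist L := by
  induction L using List.reverseRecOn with
  | nil => simp [prune]
  | append_singleton L p ih =>
    rw [prune, List.foldl_append] at *
    simp only [List.foldl_cons, List.foldl_nil]
    cases (List.foldl _ [] L).any _
    · simpa using ih
    · exact ih.trans (List.sublist_append_left _ _)

theorem sz_prune_le (M : List (List Bool)) (A : List Bool) (L : List (List Bool)) :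
    sz (prune M A L) ≤ sz L := by
  have := sz_le_of_sublist (prune_sublist M A L)
  simpa [sz_list] using this

@[fun_prop]
theorem PolyTime.prune {L : α → List (List Bool)} (hM : PolyTime M) (hA : PolyTime A)
    (hL : PolyTime L) : PolyTime fun a => prune (M a) (A a) (L a) := by
  unfold MinStableCut.prune
  refine hL.foldl (PolyTime.const _) (h := fun a acc p => bif acc.any (fun q =>
    MinStableCut.interchangeable (M a) (A a) q p) then acc else p :: acc) (by fun_prop)
    hL.size_le fun a k => ?_
  exact (sz_prune_le (M a) (A a) _).trans (sz_le_of_sublist (List.take_sublist _ _))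

@[fun_prop]
theorem PolyTime.override (hM : PolyTime M) (hA : PolyTime A) (hp : PolyTime p)
    (hq : PolyTime q) : PolyTime fun a => override (M a) (A a) (p a) (q a) := by
  unfold MinStableCut.override; fun_prop

@[fun_prop]
theorem PolyTime.union (hM : PolyTime M) (hp : PolyTime p) (hq : PolyTime q) :
    PolyTime fun a => union (M a) (p a) (q a) := by
  unfold MinStableCut.union; fun_prop

@[fun_prop]
theorem PolyTime.merge {x y : α → Table} (hM : PolyTime M) (hx : PolyTime x) (hy : PolyTime y) :
    PolyTime fun a => merge (M a) (x a) (y a) := by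
  unfold MinStableCut.merge; fun_prop

@[fun_prop]
theorem PolyTime.constList {b : α → Bool} (hM : PolyTime M) (hb : PolyTime b) :
    PolyTime fun a => constList (M a) (b a) := by
  unfold MinStableCut.constList; fun_prop

@[fun_prop]
theorem PolyTime.singleton (hM : PolyTime M) (hv : PolyTime v) :
    PolyTime fun a => singleton (M a) (v a) := by
  unfold MinStableCut.singleton; fun_prop

@[fun_prop]
theorem PolyTime.introduce {l : α → List Table} (hM : PolyTime M) (hB : PolyTime B)
    (hl : PolyTime l) (hv : PolyTime v) :
    PolyTime fun a => introduce (M a) (B a) (l a) (v a) := by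
  unfold MinStableCut.introduce; fun_prop

@[fun_prop]
theorem PolyTime.contract {l : α → List Table} {x y : α → Table} (hM : PolyTime M)
    (hl : PolyTime l) (hx : PolyTime x) (hy : PolyTime y) :
    PolyTime fun a => contract (M a) (l a) (x a) (y a) := by
  unfold MinStableCut.contract; fun_prop

@[fun_prop]
theorem PolyTime.leaves {l : α → List Table} (hT : PolyTime T) (hl : PolyTime l) :
    PolyTime fun a => leaves (T a) (l a) := by
  unfold MinStableCut.leaves; fun_prop

@[fun_prop]
theorem PolyTime.contractLeaf {l : α → List Table} (hM : PolyTime M) (hT : PolyTime T)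
    (hl : PolyTime l) : PolyTime fun a => contractLeaf (M a) (T a) (l a) := by
  unfold MinStableCut.contractLeaf; fun_prop

@[fun_prop]
theorem PolyTime.isMatching (hM : PolyTime M) : PolyTime fun a => isMatching (M a) := by
  unfold MinStableCut.isMatching; fun_prop

@[fun_prop]
theorem PolyTime.matchingCut (hM : PolyTime M) : PolyTime fun a => matchingCut (M a) := by
  unfold MinStableCut.matchingCut; fun_prop

@[fun_prop]
theorem PolyTime.best {x : α → Table} (hM : PolyTime M) (hx : PolyTime x) :
    PolyTime fun a => best (M a) (x a) := by
  unfold MinStableCut.best; fun_prop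

variable {x : α → Input}

@[fun_prop]
theorem PolyTime.initialTables (hx : PolyTime x) : PolyTime fun a => initialTables (x a) := by
  unfold MinStableCut.initialTables; fun_prop

@[fun_prop]
theorem PolyTime.introducedVertices (hx : PolyTime x) :
    PolyTime fun a => introducedVertices (x a) := by
  unfold MinStableCut.introducedVertices; fun_prop

@[fun_prop]
theorem PolyTime.rounds (hx : PolyTime x) : PolyTime fun a => rounds (x a) := by
  unfold MinStableCut.rounds; fun_prop

/-- The total size of the intermediate results. -/
structure Affordable (x : Input) (s : ℕ) : Prop where
  bag : ∀ k, sz (((introducedVertices x).take k).foldl (introduce x.1 x.2.2) (initialTables x)) ≤ s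
  contract : ∀ k, sz (((rounds x).take k).foldl (fun l _ => contractLeaf x.1 x.2.1 l)
    (bagTables x)) ≤ s

/-- Inputs together with a bound for the sizes of the intermediate results. -/
structure BudgetedInput where
  input : Input
  budget : ℕ
  affordable : Affordable input budget

/-- The budget enters the size only. The program therefore sees the bare input, while its time may
be polynomial in the budget. -/
instance : Enc BudgetedInput where
  enc x := enc x.input
  sz x := sz x.input + x.budget

@[fun_prop]
theorem PolyTime.input {x : α → BudgetedInput} (hx : PolyTime x) :
    PolyTime fun a => (x a).input := by
  have : PolyTime BudgetedInput.input :=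
    .of_term (.var 0) (fun _ _ h => h) (PolyBdd.size.mono fun x => Nat.le_add_right _ _)
  exact this.comp hx

/-- Only the two outer folds can leave polynomial size; they are charged to the budget. -/
theorem PolyTime.solve : PolyTime fun x : BudgetedInput => solve x.input := by
  have hb : PolyTime fun x : BudgetedInput => bagTables x.input :=
    PolyTime.foldl (U := sz) (by fun_prop) (by fun_prop) (by fun_prop) .size
      fun x k => (x.affordable.bag k).trans (Nat.le_add_left _ _)
  have hc : PolyTime fun x : BudgetedInput => contractAll x.input :=
    PolyTime.foldl (h := fun (x : BudgetedInput) l _ =>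
      MinStableCut.contractLeaf x.input.1 x.input.2.1 l) (by fun_prop) hb (by fun_prop) .size
      fun x k => (x.affordable.contract k).trans (Nat.le_add_left _ _)
  unfold MinStableCut.solve
  fun_prop

end PolyTime

/-- A single program solves all inputs in time polynomial in the sizes of the input and of the
intermediate results. -/
theorem exists_program : ∃ (p : Program) (c : ℕ), ∀ (x : Input) (s : ℕ), Affordable x s →
    ∃ t, p.Outputs (enc x) (enc (solve x)) t ∧ t ≤ (sz x + s + 2) ^ c := by
  obtain ⟨-, p, T, ⟨c, hc⟩, hp⟩ := PolyTime.solve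
  refine ⟨p, c, fun x s h => ?_⟩
  obtain ⟨σ, t, h1, h2, -, h4⟩ := hp ⟨x, s, h⟩ (initStore (enc x)) (by simp [initStore]; rfl)
  exact ⟨t, ⟨σ, h1, h2⟩, h4.trans (hc _)⟩

end MinStableCut

/-! ### Cuts of graphs -/

namespace MinStableCut

open scoped Finset

section Graph

variable {V : Type*} [Fintype V] (G : SimpleGraph V) [DecidableRel G.Adj]

/-- The number of cut edges at `v`. -/
def crossings (f : V → Bool) (v : V) : ℕ := #{u | G.Adj v u ∧ f u ≠ f v}

/-- The number of cut edges between `v` and vertices of `A`. -/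
def crossingsIn (A f : V → Bool) (v : V) : ℕ := #{u | G.Adj v u ∧ A u = true ∧ f u ≠ f v}

theorem crossingWeight_one (f : V → Bool) (v : V) :
    crossingWeight G (fun _ => 1) f v = crossings G f v := by
  simp only [crossingWeight, crossings, Finset.sum_const, smul_eq_mul, mul_one]
  congr 1
  ext u
  simp

theorem isStableAt_iff (f : V → Bool) (v : V) :
    IsStableAt G (fun _ => 1) f v ↔ G.degree v ≤ crossings G f v + crossings G f v := by
  rw [IsStableAt, crossingWeight_one, weightedDegree]
  simp only [Finset.sum_const, smul_eq_mul, mul_one, SimpleGraph.card_neighborFinset_eq_degree]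
  rw [div_le_iff₀ (by norm_num), ← Nat.cast_le (α := ℚ)]
  push_cast
  rw [mul_two]

/-- The graph of the cut edges. -/
def cutGraph (f : V → Bool) : SimpleGraph V where
  Adj u v := G.Adj u v ∧ f v ≠ f u
  symm := ⟨fun _ _ h => ⟨h.1.symm, h.2.symm⟩⟩
  loopless := ⟨fun _ h => h.2 rfl⟩

instance (f : V → Bool) : DecidableRel (cutGraph G f).Adj := fun u v =>
  inferInstanceAs (Decidable (G.Adj u v ∧ f v ≠ f u))

@[simp]
theorem cutGraph_adj {V : Type*} {G : SimpleGraph V} {f : V → Bool} {u v : V} :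
    (cutGraph G f).Adj u v ↔ G.Adj u v ∧ f v ≠ f u := Iff.rfl

theorem degree_cutGraph (f : V → Bool) (v : V) : (cutGraph G f).degree v = crossings G f v := by
  rw [← SimpleGraph.card_neighborFinset_eq_degree, crossings]
  congr 1
  ext u
  simp

variable [DecidableEq V]

theorem cutWeight_one (f : V → Bool) :
    cutWeight G (fun _ => 1) f = #(cutGraph G f).edgeFinset := by
  simp only [cutWeight, Finset.sum_const, smul_eq_mul, mul_one]
  congr 1
  ext e
  induction e with | h u v =>
  simp only [Finset.mem_filter, SimpleGraph.mem_edgeFinset, SimpleGraph.mem_edgeSet, Sym2.mem_iff,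
    cutGraph_adj]
  refine and_congr_right fun _ => ⟨?_, fun h => ⟨v, .inr rfl, u, .inl rfl, h⟩⟩
  rintro ⟨a, rfl | rfl, b, rfl | rfl, h⟩
  · exact absurd rfl h
  · exact h.symm
  · exact h
  · exact absurd rfl h

/-- Handshake lemma in the graph of the cut edges. -/
theorem sum_crossings (f : V → Bool) :
    ∑ v, crossings G f v = 2 * cutWeight G (fun _ => 1) f := by
  rw [cutWeight_one, ← SimpleGraph.sum_degrees_eq_twice_card_edges]
  exact Finset.sum_congr rfl fun v _ => (degree_cutGraph G f v).symm

/-- In a cut with the most edges, moving `v` to the other side exchanges the cut and the uncut edges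
at `v`, so at least half of them were cut. -/
theorem exists_isStable : ∃ f, IsStable G (fun _ => 1) f := by
  obtain ⟨f, hf⟩ := Finite.exists_max fun f : V → Bool => #(cutGraph G f).edgeFinset
  refine ⟨f, fun v => (isStableAt_iff G f v).2 ?_⟩
  set g : V → Bool := Function.update f v (!f v) with hg
  -- The two cuts differ only in edges at `v`, so their sizes can be compared through the degrees of
  -- `v`.
  have hdel : (cutGraph G f).deleteIncidenceSet v = (cutGraph G g).deleteIncidenceSet v := by
    ext a b
    simp only [SimpleGraph.deleteIncidenceSet_adj, cutGraph_adj]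
    constructor <;> rintro ⟨⟨h1, h2⟩, h3, h4⟩ <;> refine ⟨⟨h1, ?_⟩, h3, h4⟩ <;>
      simpa [hg, h3, h4] using h2
  have h1 := (cutGraph G f).card_edgeFinset_deleteIncidenceSet v
  have h2 := (cutGraph G g).card_edgeFinset_deleteIncidenceSet v
  have hcard : #((cutGraph G f).deleteIncidenceSet v).edgeFinset =
      #((cutGraph G g).deleteIncidenceSet v).edgeFinset := by
    congr 1
    ext e
    simp only [SimpleGraph.mem_edgeFinset, hdel]
  -- This excludes truncation in the subtractions of `h1` and `h2`.
  have hle : ∀ f, (cutGraph G f).degree v ≤ #(cutGraph G f).edgeFinset := fun f => by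
    rw [← SimpleGraph.card_incidenceFinset_eq_degree]
    exact Finset.card_le_card (SimpleGraph.incidenceFinset_subset _ _)
  have hsum : crossings G f v + crossings G g v = G.degree v := by
    rw [← SimpleGraph.card_neighborFinset_eq_degree, crossings, crossings,
      ← Finset.card_union_of_disjoint]
    · congr 1
      ext u
      simp only [Finset.mem_union, Finset.mem_filter, Finset.mem_univ, true_and,
        SimpleGraph.mem_neighborFinset]
      refine ⟨fun h => h.elim And.left And.left, fun h => ?_⟩
      have huv : u ≠ v := h.ne'
      simp only [h, true_and, hg, Function.update_self, Function.update_of_ne huv]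
      cases f u <;> cases f v <;> simp
    · rw [Finset.disjoint_filter]
      rintro u - ⟨h, h'⟩ ⟨-, h''⟩
      have huv : u ≠ v := h.ne'
      simp only [hg, Function.update_self, Function.update_of_ne huv] at h''
      cases hu : f u <;> cases hv : f v <;> simp_all
  have := hf g
  have := hle f
  have := hle g
  simp only [degree_cutGraph] at *
  omega

variable {G}

/-- Whether two cuts are interchangeable inside of `A`. -/
structure Interchangeable (G : SimpleGraph V) [DecidableRel G.Adj] (A p q : V → Bool) : Prop where
  stable : (∀ v, A v = true → (∀ u, G.Adj v u → A u = true) →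
      G.degree v ≤ crossingsIn G A q v + crossingsIn G A q v) →
    ∀ v, A v = true → (∀ u, G.Adj v u → A u = true) →
      G.degree v ≤ crossingsIn G A p v + crossingsIn G A p v
  weight : ∑ v with A v = true, crossingsIn G A p v = ∑ v with A v = true, crossingsIn G A q v
  boundary : ∀ v u, A v = true → G.Adj v u → A u = false →
    p v = q v ∧ crossingsIn G A p v = crossingsIn G A q v

theorem crossings_override_of_mem (A p f : V → Bool) {v : V} (hv : A v = true) :
    crossings G (fun v => bif A v then p v else f v) v =
      crossingsIn G A p v + #{u | G.Adj v u ∧ A u = false ∧ f u ≠ p v} := by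
  rw [crossings, crossingsIn, ← Finset.card_union_of_disjoint]
  · congr 1
    ext u
    simp only [Finset.mem_union, Finset.mem_filter, Finset.mem_univ, true_and, hv, cond_true]
    cases A u <;> simp
  · rw [Finset.disjoint_filter]
    rintro u - ⟨-, h, -⟩ ⟨-, h', -⟩
    simp [h] at h'

theorem crossings_override_of_mem_interior (A p f : V → Bool) {v : V} (hv : A v = true)
    (hn : ∀ u, G.Adj v u → A u = true) :
    crossings G (fun v => bif A v then p v else f v) v = crossingsIn G A p v := by
  rw [crossings_override_of_mem A p f hv, Nat.add_eq_left, Finset.card_eq_zero,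
    Finset.filter_eq_empty_iff]
  rintro u - ⟨h, h', -⟩
  simp [hn u h] at h'

/-- A boundary vertex has the same side and the same count inside `A` for both cuts. A vertex
outside of `A` sees `A` only through boundary vertices, whose sides agree. -/
theorem Interchangeable.crossings_eq {A p q : V → Bool} (h : Interchangeable G A p q)
    (f : V → Bool) {v : V} (hv : ¬ (A v = true ∧ ∀ u, G.Adj v u → A u = true)) :
    crossings G (fun v => bif A v then p v else f v) v =
      crossings G (fun v => bif A v then q v else f v) v := by
  cases hA : A v with
  | true =>
    obtain ⟨u, hu, hu'⟩ : ∃ u, G.Adj v u ∧ A u = false := by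
      simpa [hA] using hv
    obtain ⟨h1, h2⟩ := h.boundary v u hA hu hu'
    rw [crossings_override_of_mem A p f hA, crossings_override_of_mem A q f hA, h1, h2]
  | false =>
    rw [crossings, crossings]
    congr 1
    refine Finset.filter_congr fun u _ => and_congr_right fun hu => ?_
    cases hAu : A u with
    | true => simp [hA, (h.boundary u v hAu hu.symm hA).1]
    | false => simp [hA]

theorem Interchangeable.isStable {A p q : V → Bool} (h : Interchangeable G A p q) {f : V → Bool}
    (hq : IsStable G (fun _ => 1) (fun v => bif A v then q v else f v)) :
    IsStable G (fun _ => 1) (fun v => bif A v then p v else f v) := by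
  intro v
  have hqv := fun v => (isStableAt_iff G _ v).1 (hq v)
  rw [isStableAt_iff]
  by_cases hv : A v = true ∧ ∀ u, G.Adj v u → A u = true
  · rw [crossings_override_of_mem_interior A p f hv.1 hv.2]
    refine h.stable (fun w hw hw' => ?_) v hv.1 hv.2
    rw [← crossings_override_of_mem_interior A q f hw hw']
    exact hqv w
  · rw [h.crossings_eq f hv]
    exact hqv v

/-- Twice the weight is the sum of the crossings over all vertices. The sums for `p` and `q` differ
exactly as the sums of `crossingsIn` over `A` do, and those are equal. -/
theorem Interchangeable.cutWeight_eq {A p q : V → Bool} (h : Interchangeable G A p q)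
    (f : V → Bool) : cutWeight G (fun _ => 1) (fun v => bif A v then p v else f v) =
      cutWeight G (fun _ => 1) (fun v => bif A v then q v else f v) := by
  -- Stated with sums on both sides to avoid subtraction of natural numbers.
  have key : ∀ v, crossings G (fun v => bif A v then p v else f v) v +
        (if A v = true then crossingsIn G A q v else 0) =
      crossings G (fun v => bif A v then q v else f v) v +
        (if A v = true then crossingsIn G A p v else 0) := by
    intro v
    by_cases hv : A v = true ∧ ∀ u, G.Adj v u → A u = true
    · rw [crossings_override_of_mem_interior A p f hv.1 hv.2,
        crossings_override_of_mem_interior A q f hv.1 hv.2, if_pos hv.1, if_pos hv.1, add_comm]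
    · rw [h.crossings_eq f hv]
      cases hA : A v with
      | true =>
        obtain ⟨u, hu, hu'⟩ : ∃ u, G.Adj v u ∧ A u = false := by
          simpa [hA] using hv
        rw [(h.boundary v u hA hu hu').2]
      | false => simp
  have hsum := Finset.sum_congr rfl fun v (_ : v ∈ Finset.univ) => key v
  rw [Finset.sum_add_distrib, Finset.sum_add_distrib, ← Finset.sum_filter, ← Finset.sum_filter,
    h.weight, sum_crossings, sum_crossings] at hsum
  omega

end Graph

end MinStableCut

/-! ### Representation of cuts by tables -/

namespace MinStableCut

open scoped Finset

section Bits

theorem entry_ofFn {m n : ℕ} (f : Fin m → Fin n → Bool) (u : Fin m) (v : Fin n) :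
    entry (List.ofFn fun u => List.ofFn (f u)) u v = f u v := by
  simp [entry, bit]

theorem bit_map_range {n : ℕ} (f : ℕ → Bool) (v : Fin n) : bit ((List.range n).map f) v = f v := by
  simp [bit]

theorem countP_range_eq {n : ℕ} (P : ℕ → Bool) :
    (List.range n).countP P = #{u : Fin n | P u = true} := by
  rw [← List.map_coe_finRange_eq_range, List.countP_map, List.countP_eq_length_filter]
  rw [← List.toFinset_card_of_nodup ((List.nodup_finRange n).filter _)]
  congr 1
  ext u
  simp

theorem all_range_iff {n : ℕ} (P : ℕ → Bool) :
    (List.range n).all P = true ↔ ∀ u : Fin n, P u = true := by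
  simp [List.all_eq_true, Fin.forall_iff]

theorem any_range_iff {n : ℕ} (P : ℕ → Bool) :
    (List.range n).any P = true ↔ ∃ u : Fin n, P u = true := by
  simp [List.any_eq_true, Fin.exists_iff]

theorem sum_map_range (n : ℕ) (f : ℕ → ℕ) :
    ((List.range n).map f).sum = ∑ i ∈ Finset.range n, f i := by
  induction n with
  | zero => rfl
  | succ n ih => simp [List.range_succ, Finset.sum_range_succ, ih]

end Bits

variable {n : ℕ} (G : SimpleGraph (Fin n)) [DecidableRel G.Adj]

def adjList : List (List Bool) := List.ofFn fun u => List.ofFn fun v => decide (G.Adj u v)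

@[simp]
theorem length_adjList : (adjList G).length = n := by simp [adjList]

@[simp]
theorem entry_adjList (u v : Fin n) : entry (adjList G) u v = decide (G.Adj u v) :=
  entry_ofFn _ u v

/-- The function given by a list of truth values. -/
def bits (n : ℕ) (p : List Bool) (v : Fin n) : Bool := bit p v

theorem degreeAt_eq (v : Fin n) : degreeAt (adjList G) v = G.degree v := by
  rw [degreeAt, length_adjList, countP_range_eq, ← SimpleGraph.card_neighborFinset_eq_degree]
  congr 1
  ext u
  simp

theorem crossingsAt_eq (A p : List Bool) (v : Fin n) :
    crossingsAt (adjList G) A p v = crossingsIn G (bits n A) (bits n p) v := by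
  rw [crossingsAt, length_adjList, countP_range_eq, crossingsIn]
  congr 1
  ext u
  simp only [Finset.mem_filter, Finset.mem_univ, true_and, entry_adjList, Bool.and_eq_true,
    decide_eq_true_iff]
  simp [bits]

theorem isBoundary_iff (A : List Bool) (v : Fin n) : isBoundary (adjList G) A v = true ↔
    bits n A v = true ∧ ∃ u, G.Adj v u ∧ bits n A u = false := by
  rw [isBoundary, length_adjList, Bool.and_eq_true, any_range_iff]
  simp [bits]

theorem stableInside_iff (A p : List Bool) : stableInside (adjList G) A p = true ↔
    ∀ v, bits n A v = true → (∀ u, G.Adj v u → bits n A u = true) →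
      G.degree v ≤ crossingsIn G (bits n A) (bits n p) v +
        crossingsIn G (bits n A) (bits n p) v := by
  rw [stableInside, length_adjList, all_range_iff]
  refine forall_congr' fun v => ?_
  rw [Bool.or_eq_true, Bool.or_eq_true, isBoundary_iff, degreeAt_eq, crossingsAt_eq, Nat.ble_eq]
  change ((!bits n A v) = true ∨ _) ∨ _ ↔ _
  cases hv : bits n A v
  · simp
  · by_cases h : ∃ u, G.Adj v u ∧ bits n A u = false
    · simp only [h]
      obtain ⟨u, hu, hu'⟩ := h
      simp only [Bool.not_true, Bool.false_eq_true, and_self, or_true, true_or, true_iff]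
      intro _ h
      simp [h u hu] at hu'
    · have h' : ∀ u, G.Adj v u → bits n A u = true := by simpa using h
      simp only [h, Bool.not_true, Bool.false_eq_true]
      tauto

theorem weightInside_eq (A p : List Bool) : weightInside (adjList G) A p =
    ∑ v with bits n A v = true, crossingsIn G (bits n A) (bits n p) v := by
  rw [weightInside, length_adjList, List.length_flatMap, sum_map_range,
    Finset.sum_range, Finset.sum_filter]
  refine Finset.sum_congr rfl fun v _ => ?_
  rw [← List.countP_eq_length_filter, countP_range_eq]
  change #{u : Fin n | (bits n A v && _) = true} = _
  cases hv : bits n A v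
  · simp
  · rw [if_pos rfl, crossingsIn]
    congr 1
    ext u
    simp only [Finset.mem_filter, Finset.mem_univ, true_and, entry_adjList, Bool.and_eq_true,
      decide_eq_true_iff]
    simp [bits]

variable {G}

theorem Interchangeable.of_eq_true {A p q : List Bool}
    (h : interchangeable (adjList G) A p q = true) :
    Interchangeable G (bits n A) (bits n p) (bits n q) := by
  simp only [interchangeable, Bool.and_eq_true, Nat.beq_eq, length_adjList, all_range_iff] at h
  obtain ⟨h1, h2, h3⟩ := h
  refine ⟨fun h => ?_, by rwa [weightInside_eq, weightInside_eq] at h2, fun v u hv hu hu' => ?_⟩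
  · rw [← stableInside_iff] at h ⊢
    simpa [h] using h1
  · have h4 : isBoundary (adjList G) A v = true := (isBoundary_iff G A v).2 ⟨hv, u, hu, hu'⟩
    have h5 := h3 v
    rw [h4, crossingsAt_eq, crossingsAt_eq] at h5
    simpa [bits] using h5

/-- Every stable cut can be changed on `A` into one of the cuts of the list. -/
def Represents (G : SimpleGraph (Fin n)) [DecidableRel G.Adj] (A : List Bool)
    (L : List (List Bool)) : Prop :=
  ∀ f, IsStable G (fun _ => 1) f → ∃ p ∈ L,
    IsStable G (fun _ => 1) (fun v => bif bits n A v then bits n p v else f v) ∧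
    cutWeight G (fun _ => 1) (fun v => bif bits n A v then bits n p v else f v) =
      cutWeight G (fun _ => 1) f

theorem interchangeable_refl (M : List (List Bool)) (A p : List Bool) :
    interchangeable M A p p = true := by
  simp [interchangeable]

/-- A cut is dropped only in favor of one that is already kept, and kept cuts are never removed; so
transitivity is not needed. -/
theorem exists_mem_prune (M : List (List Bool)) (A : List Bool) (L : List (List Bool)) :
    ∀ p ∈ L, ∃ q ∈ prune M A L, interchangeable M A q p = true := by
  induction L using List.reverseRecOn with
  | nil => simp
  | append_singleton L p ih =>
    rw [prune, List.foldl_append, ← prune]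
    simp only [List.foldl_cons, List.foldl_nil]
    intro p' hp'
    cases h : (prune M A L).any fun q => interchangeable M A q p with
    | true =>
      rcases List.mem_append.1 hp' with hp' | hp'
      · exact ih p' hp'
      · rw [List.mem_singleton.1 hp']
        exact List.any_eq_true.1 h
    | false =>
      rcases List.mem_append.1 hp' with hp' | hp'
      · obtain ⟨q, hq, hq'⟩ := ih p' hp'
        exact ⟨q, List.mem_cons_of_mem _ hq, hq'⟩
      · rw [List.mem_singleton.1 hp']
        exact ⟨p, List.mem_cons_self, interchangeable_refl M A p⟩

theorem prune_pairwise (M : List (List Bool)) (A : List Bool) (L : List (List Bool)) :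
    (prune M A L).Pairwise fun p q => interchangeable M A q p = false := by
  induction L using List.reverseRecOn with
  | nil => simp [prune]
  | append_singleton L p ih =>
    rw [prune, List.foldl_append, ← prune]
    simp only [List.foldl_cons, List.foldl_nil]
    cases h : (prune M A L).any fun q => interchangeable M A q p with
    | true => exact ih
    | false => exact List.pairwise_cons.2 ⟨by simpa using h, ih⟩

theorem Represents.prune {A : List Bool} {L : List (List Bool)} (h : Represents G A L) :
    Represents G A (prune (adjList G) A L) := by
  intro f hf
  obtain ⟨p, hp, h1, h2⟩ := h f hf
  obtain ⟨q, hq, hqp⟩ := exists_mem_prune (adjList G) A L p hp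
  have hi := Interchangeable.of_eq_true hqp
  exact ⟨q, hq, hi.isStable h1, (hi.cutWeight_eq f).trans h2⟩

theorem bits_union (A B : List Bool) (v : Fin n) :
    bits n (union (adjList G) A B) v = (bits n A v || bits n B v) := by
  rw [bits, union, length_adjList, bit_map_range]
  rfl

theorem bits_override (A p q : List Bool) (v : Fin n) :
    bits n (override (adjList G) A p q) v = bif bits n A v then bits n p v else bits n q v := by
  rw [bits, override, length_adjList, bit_map_range]
  rfl

theorem bits_constList (b : Bool) (v : Fin n) : bits n (constList (adjList G) b) v = b := by
  rw [bits, constList, length_adjList, bit_map_range]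

/-- The exchange on the second set produces a stable cut of the same weight, to which the exchange
on the first set applies. On an overlap the first table wins, as in `override`. -/
theorem Represents.merge {x y : Table} (hx : Represents G x.2.1 x.2.2)
    (hy : Represents G y.2.1 y.2.2) :
    Represents G (merge (adjList G) x y).2.1 (merge (adjList G) x y).2.2 := by
  refine Represents.prune fun f hf => ?_
  obtain ⟨q, hq, h1, h2⟩ := hy f hf
  obtain ⟨p, hp, h3, h4⟩ := hx _ h1
  refine ⟨override (adjList G) x.2.1 p q,
    List.mem_flatMap.2 ⟨p, hp, List.mem_map.2 ⟨q, hq, rfl⟩⟩, ?_⟩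
  have : (fun v => bif bits n (union (adjList G) x.2.1 y.2.1) v then
      bits n (override (adjList G) x.2.1 p q) v else f v) = fun v => bif bits n x.2.1 v then
      bits n p v else bif bits n y.2.1 v then bits n q v else f v := by
    funext v
    rw [bits_union, bits_override]
    cases bits n x.2.1 v <;> cases bits n y.2.1 v <;> rfl
  have hu : (MinStableCut.merge (adjList G) x y).2.1 = union (adjList G) x.2.1 y.2.1 := rfl
  rw [hu, this]
  exact ⟨h3, h4.trans h2⟩

theorem represents_empty {A : List Bool} (hA : ∀ v, bits n A v = false) (p : List Bool) :
    Represents G A [p] := by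
  intro f hf
  refine ⟨p, List.mem_singleton_self p, ?_⟩
  simp only [hA, cond_false]
  exact ⟨hf, trivial⟩

theorem bits_singleton (u v : Fin n) :
    bits n (singleton (adjList G) u).2.1 v = decide (v = u) := by
  rw [bits, singleton, length_adjList, bit_map_range, Bool.eq_iff_iff, Nat.beq_eq,
    decide_eq_true_iff, Fin.ext_iff]

theorem represents_singleton (u : Fin n) :
    Represents G (singleton (adjList G) u).2.1 (singleton (adjList G) u).2.2 := by
  intro f hf
  refine ⟨constList (adjList G) (f u), ?_, ?_⟩
  · cases f u <;> simp [singleton]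
  · have : (fun v => bif bits n (singleton (adjList G) u).2.1 v then
        bits n (constList (adjList G) (f u)) v else f v) = f := by
      funext v
      rw [bits_singleton, bits_constList]
      by_cases h : v = u <;> simp [h]
    rw [this]
    exact ⟨hf, rfl⟩

theorem crossingsIn_le_degree (A p : Fin n → Bool) (v : Fin n) :
    crossingsIn G A p v ≤ G.degree v := by
  rw [← SimpleGraph.card_neighborFinset_eq_degree]
  refine Finset.card_le_card fun u hu => ?_
  simp only [Finset.mem_filter, Finset.mem_univ, true_and] at hu
  simpa using hu.1

theorem weightInside_le (A p : List Bool) : weightInside (adjList G) A p ≤ n * n := by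
  rw [weightInside_eq]
  calc _ ≤ ∑ v : Fin n, crossingsIn G (bits n A) (bits n p) v :=
        Finset.sum_le_sum_of_subset (Finset.filter_subset _ _)
    _ ≤ ∑ v : Fin n, n := Finset.sum_le_sum fun v _ =>
        (Finset.card_le_univ _).trans (Fintype.card_fin n).le
    _ = n * n := by simp

/-- Pigeonhole: the sides and counts on `S`, the stability flag and the inner weight determine the
class of a cut, and `prune` keeps no two cuts of one class. -/
theorem length_prune_le (A : List Bool) (L : List (List Bool)) (S : Finset (Fin n))
    (hS : ∀ v u, bits n A v = true → G.Adj v u → bits n A u = false → v ∈ S) :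
    (prune (adjList G) A L).length ≤ (2 * (G.maxDegree + 1)) ^ #S * (2 * (n * n + 1)) := by
  let φ : List Bool → (S → Bool × Fin (G.maxDegree + 1)) × Bool × Fin (n * n + 1) := fun p =>
    (fun v => (bits n p v, ⟨crossingsAt (adjList G) A p v.1, by
      rw [crossingsAt_eq]
      exact Nat.lt_succ_of_le ((crossingsIn_le_degree _ _ _).trans (G.degree_le_maxDegree _))⟩),
      stableInside (adjList G) A p,
      ⟨weightInside (adjList G) A p, Nat.lt_succ_of_le (weightInside_le A p)⟩)
  have hφ : ∀ p q, φ p = φ q → interchangeable (adjList G) A q p = true := by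
    intro p q h
    simp only [φ, Prod.mk.injEq, Fin.mk.injEq, funext_iff, Subtype.forall] at h
    obtain ⟨h1, h2, h3⟩ := h
    simp only [interchangeable, h2, h3, Bool.and_eq_true, length_adjList, all_range_iff]
    refine ⟨by simp, by simp, fun v => ?_⟩
    cases hv : isBoundary (adjList G) A v with
    | false => rfl
    | true =>
      obtain ⟨hv1, u, hu, hu'⟩ := (isBoundary_iff G A v).1 hv
      obtain ⟨h4, h5⟩ := h1 v (hS v u hv1 hu hu')
      simp only [bits] at h4
      simp [h4, h5]
  have hnd : ((prune (adjList G) A L).map φ).Nodup := by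
    rw [List.Nodup, List.pairwise_map]
    refine (prune_pairwise (adjList G) A L).imp fun {p q} h h' => ?_
    rw [hφ p q h'] at h
    exact absurd h (by simp)
  have := hnd.length_le_card
  simpa using this

end MinStableCut

/-! ### Complete tables and graphs of maximum degree one -/

namespace MinStableCut

open Enc
open scoped Finset

variable {n : ℕ} {G : SimpleGraph (Fin n)} [DecidableRel G.Adj]

theorem crossingsIn_of_forall {A : Fin n → Bool} (hA : ∀ v, A v = true) (p : Fin n → Bool)
    (v : Fin n) : crossingsIn G A p v = crossings G p v := by
  simp [crossingsIn, crossings, hA]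

theorem stableInside_iff_isStable {A : List Bool} (hA : ∀ v, bits n A v = true) (p : List Bool) :
    stableInside (adjList G) A p = true ↔ IsStable G (fun _ => 1) (bits n p) := by
  simp [stableInside_iff, hA, crossingsIn_of_forall hA, IsStable, isStableAt_iff]

theorem weightInside_eq_cutWeight {A : List Bool} (hA : ∀ v, bits n A v = true) (p : List Bool) :
    weightInside (adjList G) A p = 2 * cutWeight G (fun _ => 1) (bits n p) := by
  simp [weightInside_eq, hA, crossingsIn_of_forall hA, sum_crossings]

theorem best_spec {x : Table} (hA : ∀ v, bits n x.2.1 v = true)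
    (hx : Represents G x.2.1 x.2.2) :
    best (adjList G) x ∈ x.2.2 ∧ IsUnweightedOptimal G (bits n (best (adjList G) x)) := by
  have hrep : ∀ f, IsStable G (fun _ => 1) f → ∃ p ∈ x.2.2, IsStable G (fun _ => 1) (bits n p) ∧
      cutWeight G (fun _ => 1) (bits n p) = cutWeight G (fun _ => 1) f := by
    intro f hf
    obtain ⟨p, hp, h1, h2⟩ := hx f hf
    simp only [hA, cond_true] at h1 h2
    exact ⟨p, hp, h1, h2⟩
  set L := x.2.2.filter fun p => stableInside (adjList G) x.2.1 p && x.2.2.all fun q =>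
    !stableInside (adjList G) x.2.1 q ||
      Nat.ble (weightInside (adjList G) x.2.1 p) (weightInside (adjList G) x.2.1 q) with hL
  have hmem : ∀ p, p ∈ L ↔ p ∈ x.2.2 ∧ IsStable G (fun _ => 1) (bits n p) ∧ ∀ q ∈ x.2.2,
      IsStable G (fun _ => 1) (bits n q) →
        cutWeight G (fun _ => 1) (bits n p) ≤ cutWeight G (fun _ => 1) (bits n q) := by
    intro p
    simp only [hL, List.mem_filter, Bool.and_eq_true, List.all_eq_true, Bool.or_eq_true,
      Bool.not_eq_true', Nat.ble_eq, weightInside_eq_cutWeight hA, ← Bool.not_eq_true,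
      stableInside_iff_isStable hA]
    refine and_congr_right fun _ => and_congr_right fun _ => forall₂_congr fun q _ => ?_
    rw [← imp_iff_not_or]
    exact imp_congr_right fun _ => by omega
  -- Here the existence of a stable cut is needed; it keeps the default of `headD` out of play.
  have hne : L ≠ [] := by
    obtain ⟨f, hf⟩ := exists_isStable G
    obtain ⟨p, hp, h1, -⟩ := hrep f hf
    classical
    obtain ⟨q, hq, hmin⟩ := Finset.exists_min_image
      (x.2.2.toFinset.filter fun p => IsStable G (fun _ => 1) (bits n p))
      (fun p => cutWeight G (fun _ => 1) (bits n p)) ⟨p, by simp [hp, h1]⟩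
    simp only [Finset.mem_filter, List.mem_toFinset, and_imp] at hq hmin
    exact List.ne_nil_of_mem ((hmem q).2 ⟨hq.1, hq.2, hmin⟩)
  have hbest : best (adjList G) x ∈ L := by
    rw [best, ← hL]
    cases h : L with
    | nil => exact absurd h hne
    | cons p l => simp
  obtain ⟨h1, h2, h3⟩ := (hmem _).1 hbest
  refine ⟨h1, h2, fun f hf => ?_⟩
  obtain ⟨p, hp, h4, h5⟩ := hrep f hf
  exact (h3 p hp h4).trans h5.le

theorem isMatching_iff : isMatching (adjList G) = true ↔ ∀ v, G.degree v ≤ 1 := by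
  rw [isMatching, length_adjList, all_range_iff]
  simp [degreeAt_eq]

theorem bits_matchingCut (v : Fin n) :
    bits n (matchingCut (adjList G)) v = true ↔ ∃ u, u < v ∧ G.Adj v u := by
  rw [bits, matchingCut, length_adjList, bit_map_range, any_range_iff]
  simp only [Bool.and_eq_true, Bool.not_eq_true', ← Bool.not_eq_true, Nat.ble_eq, not_le,
    Fin.val_fin_lt, entry_adjList, decide_eq_true_iff]

theorem crossings_le_degree (f : Fin n → Bool) (v : Fin n) : crossings G f v ≤ G.degree v := by
  rw [← crossingsIn_of_forall (A := fun _ => true) fun _ => rfl]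
  exact crossingsIn_le_degree _ _ v

/-- The larger end of an edge gets `true`. The smaller end has no other neighbor, hence no smaller
one, and gets `false`. -/
theorem crossings_matchingCut (h : ∀ v, G.degree v ≤ 1) (v : Fin n) :
    crossings G (bits n (matchingCut (adjList G))) v = G.degree v := by
  rw [crossings, ← SimpleGraph.card_neighborFinset_eq_degree]
  congr 1
  ext u
  simp only [Finset.mem_filter, Finset.mem_univ, true_and, SimpleGraph.mem_neighborFinset,
    and_iff_left_iff_imp]
  have huniq : ∀ {a b c}, G.Adj a b → G.Adj a c → b = c := by
    intro a b c hb hc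
    have := h a
    rw [← SimpleGraph.card_neighborFinset_eq_degree, Finset.card_le_one] at this
    exact this b (by simpa) c (by simpa)
  have key : ∀ {a b}, a < b → G.Adj a b → bits n (matchingCut (adjList G)) a ≠
      bits n (matchingCut (adjList G)) b := by
    intro a b hab hadj
    have hb := (bits_matchingCut b).2 ⟨a, hab, hadj.symm⟩
    rw [hb, ne_eq, bits_matchingCut]
    rintro ⟨c, hc, hc'⟩
    rw [huniq hc' hadj] at hc
    exact absurd hc hab.asymm
  intro hvu
  rcases lt_or_gt_of_ne hvu.ne with hlt | hlt
  · exact (key hlt hvu).symm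
  · exact key hlt hvu.symm

/-- Stability at a vertex of degree one forces its edge to be cut, so all stable cuts have the same
weight. -/
theorem represents_matchingCut (h : ∀ v, G.degree v ≤ 1) {A : List Bool}
    (hA : ∀ v, bits n A v = true) : Represents G A [matchingCut (adjList G)] := by
  intro f hf
  refine ⟨_, List.mem_singleton_self _, ?_⟩
  simp only [hA, cond_true]
  refine ⟨fun v => ?_, ?_⟩
  · rw [isStableAt_iff, crossings_matchingCut h]
    omega
  · have : ∀ v, crossings G (bits n (matchingCut (adjList G))) v = crossings G f v := by
      intro v
      rw [crossings_matchingCut h]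
      have h1 := (isStableAt_iff G f v).1 (hf v)
      have h2 := h v
      have h3 := crossings_le_degree (G := G) f v
      omega
    have hsum := Finset.sum_congr rfl fun v (_ : v ∈ Finset.univ) => this v
    rw [sum_crossings, sum_crossings] at hsum
    exact Nat.eq_of_mul_eq_mul_left two_pos hsum

end MinStableCut

/-! ### Contractions of tree decompositions -/

namespace MinStableCut

open scoped Finset

variable {n N : ℕ} {G : SimpleGraph (Fin n)} (D : TreeDecomposition G (Fin N))

/-- A partition of the nodes into groups that are represented by one of their nodes, such that
only representatives are adjacent to nodes of other groups. -/
structure IsGrouping (T : SimpleGraph (Fin N)) (grp : Fin N → Fin N) : Prop where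
  idem : ∀ r, grp (grp r) = grp r
  sep : ∀ r s, T.Adj r s → grp r ≠ grp s → grp r = r ∧ grp s = s

variable {D} {grp : Fin N → Fin N}

theorem isGrouping_id (T : SimpleGraph (Fin N)) : IsGrouping T fun r => r :=
  ⟨fun _ => rfl, fun _ _ _ _ => ⟨rfl, rfl⟩⟩

/-- The edge from `v` to `u` lies in a bag of another group. A walk to that bag through nodes
containing `v` must leave the group, and it can leave only from the representative. -/
theorem IsGrouping.mem_bag {D : TreeDecomposition G (Fin N)} (h : IsGrouping D.tree grp)
    {v u : Fin n} {r : Fin N} (hv : v ∈ D.bag r) (hvu : G.Adj v u)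
    (hu : ∀ s, grp s = grp r → u ∉ D.bag s) : v ∈ D.bag (grp r) := by
  obtain ⟨s, hs, hs'⟩ := D.exists_edge_bag v u hvu
  have hne : grp r ≠ grp s := fun h => hu s h.symm hs'
  obtain ⟨w⟩ := (D.connected v).preconnected ⟨r, hv⟩ ⟨s, hs⟩
  have key : ∀ (a b : {t | v ∈ D.bag t}), (D.tree.induce {t | v ∈ D.bag t}).Walk a b →
      grp a ≠ grp b → v ∈ D.bag (grp a) := by
    intro a b w
    induction w with
    | nil => intro h; exact absurd rfl h
    | @cons a c b hac _ ih =>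
      intro hab
      by_cases hc : grp c = grp a
      · rw [← hc]
        exact ih (hc ▸ hab)
      · rw [(h.sep a c hac (Ne.symm hc)).1]
        exact a.2
  exact key _ _ w hne

/-- Only an edge from `t` to another group could violate separation, since `t` ceases to be a
representative; by `hleaf` such an edge leads to `s` and becomes internal. -/
theorem IsGrouping.contract {T : SimpleGraph (Fin N)} (h : IsGrouping T grp) {t s : Fin N}
    (hts : T.Adj t s) (hs : grp s = s)
    (hleaf : ∀ r, T.Adj t r → grp r = r → r = s) :
    IsGrouping T fun r => if grp r = t then s else grp r := by
  have hst : s ≠ t := hts.ne'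
  refine ⟨fun r => ?_, fun r q hrq hne => ?_⟩
  · by_cases hr : grp r = t
    · simp [hr, hs, hst]
    · simp [hr, h.idem]
  · have hne' : grp r ≠ grp q := fun h => hne (by rw [h])
    obtain ⟨h1, h2⟩ := h.sep r q hrq hne'
    rw [h1, h2] at hne ⊢
    by_cases hr : r = t
    · subst hr
      exact absurd (hleaf q hrq h2) fun hq => hne (by simp [hq, hst])
    · by_cases hq : q = t
      · subst hq
        exact absurd (hleaf r hrq.symm h1) fun hr => hne (by simp [hr, hst])
      · simp [hr, hq]

/-- The representatives induce a tree: acyclicity is inherited, and `grp` projects walks of `T` to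
walks between representatives. A tree with at least two vertices has a leaf. -/
theorem IsGrouping.exists_leaf {T : SimpleGraph (Fin N)} (hT : T.IsTree) (h : IsGrouping T grp)
    {a b : Fin N} (hab : grp a ≠ grp b) :
    ∃ t s, grp t = t ∧ grp s = s ∧ T.Adj t s ∧ ∀ r, T.Adj t r → grp r = r → r = s := by
  classical
  set H := T.induce {t | grp t = t} with hH
  have hreach : ∀ a b, T.Walk a b →
      H.Reachable ⟨grp a, h.idem a⟩ ⟨grp b, h.idem b⟩ := by
    intro a b w
    induction w with
    | nil => rfl
    | @cons a c b hac _ ih =>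
      by_cases hc : grp a = grp c
      · simp only [hc]
        exact ih
      · refine SimpleGraph.Reachable.trans (SimpleGraph.Adj.reachable ?_) ih
        obtain ⟨h1, h2⟩ := h.sep a c hac hc
        change T.Adj (grp a) (grp c)
        rwa [h1, h2]
  have hconn : H.Connected := by
    have : Nonempty {t | grp t = t} := ⟨⟨grp a, h.idem a⟩⟩
    refine ⟨fun x y => ?_⟩
    obtain ⟨w⟩ := hT.connected.preconnected x.1 y.1
    have := hreach _ _ w
    simpa only [show grp x.1 = x.1 from x.2, show grp y.1 = y.1 from y.2] using this
  have htree : H.IsTree := ⟨hconn, hT.isAcyclic.induce _⟩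
  have : Nontrivial {t | grp t = t} :=
    ⟨⟨⟨grp a, h.idem a⟩, ⟨grp b, h.idem b⟩, fun he => hab (congrArg Subtype.val he)⟩⟩
  obtain ⟨t, ht⟩ := htree.exists_vert_degree_one_of_nontrivial
  obtain ⟨s, hs, huniq⟩ := SimpleGraph.degree_eq_one_iff_existsUnique_adj.1 ht
  exact ⟨t, s, t.2, s.2, hs, fun r hr hr' => congrArg Subtype.val (huniq ⟨r, hr'⟩ hr)⟩

end MinStableCut

/-! ### Correctness and sizes of the intermediate results -/

namespace MinStableCut

open Enc
open scoped Finset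

variable {n N : ℕ} {G : SimpleGraph (Fin n)}

theorem card_bag_le (D : TreeDecomposition G (Fin N)) (t : Fin N) : #(D.bag t) ≤ D.width + 1 := by
  have := Finset.le_sup (f := fun t => #(D.bag t)) (Finset.mem_univ t)
  unfold TreeDecomposition.width
  omega

/-- The characteristic vectors of the bags. -/
def bagList (D : TreeDecomposition G (Fin N)) : List (List Bool) := List.ofFn fun t => List.ofFn fun v => decide (v ∈ D.bag t)

@[simp]
theorem entry_bagList (D : TreeDecomposition G (Fin N)) (t : Fin N) (v : Fin n) :
    entry (bagList D) t v = decide (v ∈ D.bag t) := entry_ofFn _ t v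

variable [DecidableRel G.Adj]

/-- Well-formed tables that represent all stable cuts by at most `K` cuts. -/
structure IsValid (G : SimpleGraph (Fin n)) [DecidableRel G.Adj] (K : ℕ) (x : Table) : Prop where
  length_set : x.2.1.length = n
  length_cut : ∀ p ∈ x.2.2, p.length = n
  length_le : x.2.2.length ≤ K
  represents : Represents G x.2.1 x.2.2

/-- The bound for the length of tables whose boundaries have at most `w + 1` vertices. -/
def tableBound (G : SimpleGraph (Fin n)) [DecidableRel G.Adj] (w : ℕ) : ℕ :=
  (2 * (G.maxDegree + 1)) ^ (w + 1) * (2 * (n * n + 1))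

theorem one_le_tableBound (w : ℕ) : 1 ≤ tableBound G w :=
  Nat.one_le_iff_ne_zero.2 (by unfold tableBound; positivity)

/-- The lengths of the two tables play no role: pruning restores the bound after every merge, so it
does not accumulate. -/
theorem isValid_merge {w : ℕ} {x y : Table} (hx : Represents G x.2.1 x.2.2)
    (hy : Represents G y.2.1 y.2.2) {S : Finset (Fin n)} (hS : #S ≤ w + 1)
    (hxy : ∀ v u, (bits n x.2.1 v || bits n y.2.1 v) = true → G.Adj v u →
      (bits n x.2.1 u || bits n y.2.1 u) = false → v ∈ S) :
    IsValid G (tableBound G w) (merge (adjList G) x y) where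
  length_set := by simp [merge, union]
  length_cut p hp := by
    have : p ∈ (prune _ _ _).reverse := List.mem_reverse.2 hp
    have := (prune_sublist _ _ _).subset this
    simp only [List.mem_flatMap, List.mem_map] at this
    obtain ⟨p, -, q, -, rfl⟩ := this
    simp [override]
  length_le := by
    refine (length_prune_le _ _ S fun v u hv hvu hu => hxy v u ?_ hvu ?_).trans ?_
    · rwa [← bits_union (G := G)]
    · rwa [← bits_union (G := G)]
    · exact Nat.mul_le_mul_right _ (Nat.pow_le_pow_right (by omega) hS)
  represents := hx.merge hy

/-! ### Building the tables of the bags vertex by vertex -/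

section Bags

variable (D : TreeDecomposition G (Fin N))

/-- The tables contain the vertices below `k` of the bags. -/
structure IsPartialBagTables (k : ℕ) (l : List Table) : Prop where
  keys : l.map Prod.fst = List.range N
  valid : ∀ x ∈ l, IsValid G (tableBound G D.width) x
  mem_iff : ∀ x ∈ l, ∀ t : Fin N, x.1 = t → ∀ v, bits n x.2.1 v = true ↔ v ∈ D.bag t ∧ v.1 < k

variable {D}

theorem IsPartialBagTables.exists_key {k : ℕ} {l : List Table} (h : IsPartialBagTables D k l)
    {x : Table} (hx : x ∈ l) : ∃ t : Fin N, x.1 = t := by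
  have : x.1 ∈ List.range N := h.keys ▸ List.mem_map_of_mem hx
  exact ⟨⟨x.1, List.mem_range.1 this⟩, rfl⟩

theorem isPartialBagTables_zero : IsPartialBagTables D 0 ((List.range N).map fun t =>
    (t, constList (adjList G) false, [constList (adjList G) false])) := by
  have hempty : ∀ v, bits n (constList (adjList G) false) v = false := bits_constList false
  refine ⟨by simp [Function.comp_def], fun x hx => ?_, fun x hx t _ v => ?_⟩
  · obtain ⟨t, -, rfl⟩ := List.mem_map.1 hx
    exact ⟨by simp [constList], by simp [constList], by simpa using one_le_tableBound _,
      represents_empty hempty _⟩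
  · obtain ⟨t, -, rfl⟩ := List.mem_map.1 hx
    simp [hempty]

theorem IsPartialBagTables.introduce {l : List Table} {v : Fin n}
    (h : IsPartialBagTables D v l) :
    IsPartialBagTables D (v + 1) (introduce (adjList G) (bagList D) l v) := by
  have hbits : ∀ x ∈ l, ∀ t : Fin N, x.1 = t → v ∈ D.bag t → ∀ u,
      (bits n (singleton (adjList G) v).2.1 u || bits n x.2.1 u) = true ↔
        u ∈ D.bag t ∧ u.1 < v.1 + 1 := by
    intro x hx t ht hvt u
    rw [Bool.or_eq_true, h.mem_iff x hx t ht, bits_singleton, decide_eq_true_iff]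
    constructor
    · rintro (rfl | ⟨h1, h2⟩)
      · exact ⟨hvt, by omega⟩
      · exact ⟨h1, by omega⟩
    · rintro ⟨h1, h2⟩
      rcases Nat.lt_succ_iff_lt_or_eq.1 h2 with h2 | h2
      · exact .inr ⟨h1, h2⟩
      · exact .inl (Fin.ext h2)
  refine ⟨?_, fun y hy => ?_, fun y hy t ht u => ?_⟩
  · rw [← h.keys, MinStableCut.introduce, List.map_map]
    refine List.map_congr_left fun x _ => ?_
    rw [Function.comp_apply]
    cases entry (bagList D) x.1 v <;> rfl
  · obtain ⟨x, hx, rfl⟩ := List.mem_map.1 hy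
    obtain ⟨t, ht⟩ := h.exists_key hx
    rw [ht, entry_bagList]
    by_cases hvt : v ∈ D.bag t
    · simp only [hvt, decide_true, cond_true]
      -- The whole set lies in the bag, which therefore contains the boundary.
      refine isValid_merge (represents_singleton v) (h.valid x hx).represents (card_bag_le D t)
        fun u _ hu _ _ => ((hbits x hx t ht hvt u).1 hu).1
    · simpa only [hvt, decide_false, cond_false] using h.valid x hx
  · obtain ⟨x, hx, rfl⟩ := List.mem_map.1 hy
    have ht' : x.1 = t := by
      rw [← ht]
      cases entry (bagList D) x.1 v <;> rfl
    rw [ht', entry_bagList]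
    by_cases hvt : v ∈ D.bag t
    · simp only [hvt, decide_true, cond_true]
      rw [← hbits x hx t ht' hvt u, ← bits_union (G := G)]
      rfl
    · simp only [hvt, decide_false, cond_false]
      rw [h.mem_iff x hx t ht']
      refine and_congr_right fun hu => ⟨fun h => by omega, fun h => ?_⟩
      rcases Nat.lt_succ_iff_lt_or_eq.1 h with h | h
      · exact h
      · exact absurd (Fin.ext h ▸ hu) hvt

theorem isPartialBagTables_foldl {l : List Table} (h : IsPartialBagTables D 0 l) :
    ∀ k ≤ n, IsPartialBagTables D k
      ((List.range k).foldl (introduce (adjList G) (bagList D)) l) := by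
  intro k
  induction k with
  | zero => exact fun _ => h
  | succ k ih =>
    intro hk
    rw [List.range_succ, List.foldl_append]
    exact (ih (by omega)).introduce (v := ⟨k, hk⟩)

end Bags

/-! ### Merging leaves of the tree of tables -/

section Contraction

/-- The tables of the groups of nodes of a contracted tree decomposition. -/
structure IsContraction (D : TreeDecomposition G (Fin N)) (grp : Fin N → Fin N)
    (l : List Table) : Prop where
  isGrouping : IsGrouping D.tree grp
  nodup : (l.map Prod.fst).Nodup
  valid : ∀ x ∈ l, IsValid G (tableBound G D.width) x
  key : ∀ x ∈ l, ∃ t : Fin N, x.1 = t ∧ grp t = t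
  mem_iff : ∀ x ∈ l, ∀ t : Fin N, x.1 = t → ∀ v,
    bits n x.2.1 v = true ↔ ∃ r, grp r = t ∧ v ∈ D.bag r
  exists_table : ∀ r, ∃ x ∈ l, x.1 = grp r

variable {D : TreeDecomposition G (Fin N)} {grp : Fin N → Fin N} {l : List Table}

theorem IsPartialBagTables.isContraction (h : IsPartialBagTables D n l) :
    IsContraction D (fun r => r) l where
  isGrouping := isGrouping_id _
  nodup := h.keys ▸ List.nodup_range
  valid := h.valid
  key x hx := (h.exists_key hx).imp fun t ht => ⟨ht, rfl⟩
  mem_iff x hx t ht v := by simp [h.mem_iff x hx t ht]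
  exists_table r := by
    have : r.1 ∈ l.map Prod.fst := h.keys ▸ List.mem_range.2 r.2
    exact List.mem_map.1 this

/-- The merged table belongs to the union of the groups of `t` and `s`. Its boundary is contained in
the bag of `s` by `IsGrouping.mem_bag` for the new grouping. -/
theorem IsContraction.contract (h : IsContraction D grp l) {x y : Table} (hx : x ∈ l)
    (hy : y ∈ l) {t s : Fin N} (ht : x.1 = t) (hs : y.1 = s) (hts : D.tree.Adj t s)
    (hleaf : ∀ r, D.tree.Adj t r → grp r = r → r = s) :
    IsContraction D (fun r => if grp r = t then s else grp r) (contract (adjList G) l x y) := by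
  have hst : s ≠ t := hts.ne'
  have hss : grp s = s := by
    obtain ⟨s', hs', hs''⟩ := h.key y hy
    rwa [Fin.ext (hs.symm.trans hs')]
  have hgrp := h.isGrouping.contract hts hss hleaf
  have hmem : ∀ z' ∈ MinStableCut.contract (adjList G) l x y, ∃ z ∈ l, z.1 ≠ x.1 ∧ z'.1 = z.1 ∧
      z' = if z.1 = s then merge (adjList G) x z else z := by
    intro z' hz'
    obtain ⟨z, hz, rfl⟩ := List.mem_map.1 hz'
    obtain ⟨hz, hzx⟩ := List.mem_filter.1 hz
    have hzx' : z.1 ≠ x.1 := by simpa [← Bool.not_eq_true, Nat.beq_eq] using hzx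
    refine ⟨z, hz, hzx', ?_⟩
    by_cases hzs : z.1 = s
    · have : Nat.beq z.1 y.1 = true := Nat.beq_eq.mpr (hzs.trans hs.symm)
      simp only [this, cond_true, if_pos hzs]
      exact ⟨rfl, trivial⟩
    · have : Nat.beq z.1 y.1 = false := by
        rw [← Bool.not_eq_true, Nat.beq_eq, hs]
        exact hzs
      simp only [this, cond_false, if_neg hzs]
      exact ⟨trivial, trivial⟩
  have hbits : ∀ z ∈ l, z.1 = s → ∀ v, (bits n x.2.1 v || bits n z.2.1 v) = true ↔
      ∃ r, (if grp r = t then s else grp r) = s ∧ v ∈ D.bag r := by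
    intro z hz hzs v
    rw [Bool.or_eq_true, h.mem_iff x hx t ht, h.mem_iff z hz s hzs, ← exists_or]
    refine exists_congr fun r => ?_
    rw [← or_and_right]
    refine and_congr_left fun _ => ?_
    by_cases hr : grp r = t <;> simp [hr]
  refine ⟨hgrp, ?_, fun z' hz' => ?_, fun z' hz' => ?_, fun z' hz' q hq v => ?_, fun r => ?_⟩
  · have : (MinStableCut.contract (adjList G) l x y).map Prod.fst =
        (l.filter fun z => !Nat.beq z.1 x.1).map Prod.fst := by
      rw [MinStableCut.contract, List.map_map]
      refine List.map_congr_left fun z _ => ?_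
      rw [Function.comp_apply]
      cases Nat.beq z.1 y.1 <;> rfl
    rw [this]
    exact h.nodup.sublist (List.filter_sublist.map _)
  · obtain ⟨z, hz, hzx, -, rfl⟩ := hmem z' hz'
    by_cases hzs : z.1 = s
    · rw [if_pos hzs]
      refine isValid_merge (h.valid x hx).represents (h.valid z hz).represents (card_bag_le D s)
        fun v u hv hvu hu => ?_
      obtain ⟨r, hr, hvr⟩ := (hbits z hz hzs v).1 hv
      have := hgrp.mem_bag hvr hvu fun q hq huq => by
        have := (hbits z hz hzs u).2 ⟨q, hq.trans hr, huq⟩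
        rw [hu] at this
        exact absurd this (by simp)
      rwa [hr] at this
    · rw [if_neg hzs]
      exact h.valid z hz
  · obtain ⟨z, hz, hzx, hz1, -⟩ := hmem z' hz'
    obtain ⟨q, hq, hq'⟩ := h.key z hz
    refine ⟨q, hz1.trans hq, ?_⟩
    have : q ≠ t := fun h => hzx (by rw [hq, h, ht])
    simp [hq', this]
  · obtain ⟨z, hz, hzx, hz1, hzz⟩ := hmem z' hz'
    have hq' : z.1 = q := hz1.symm.trans hq
    have hqt : q ≠ t := fun h => hzx (by rw [hq', h, ht])
    by_cases hzs : z.1 = s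
    · have hqs : q = s := Fin.ext (hq'.symm.trans hzs)
      rw [hzz, if_pos hzs, hqs, ← hbits z hz hzs v, ← bits_union (G := G)]
      rfl
    · have hqs : q ≠ s := fun h => hzs (hq'.trans (congrArg Fin.val h))
      rw [hzz, if_neg hzs, h.mem_iff z hz q hq']
      refine exists_congr fun r => and_congr_left fun _ => ?_
      by_cases hr : grp r = t
      · simp [hr, hqt.symm, hqs.symm]
      · simp [hr]
  · have hq : ∀ q : Fin N, grp q = q → q ≠ t →
        ∃ z' ∈ MinStableCut.contract (adjList G) l x y, z'.1 = q := by
      intro q hq hqt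
      obtain ⟨z, hz, hzq⟩ := h.exists_table q
      rw [hq] at hzq
      refine ⟨_, List.mem_map_of_mem (List.mem_filter.2 ⟨hz, ?_⟩), ?_⟩
      · rw [Bool.not_eq_true', ← Bool.not_eq_true, Nat.beq_eq, hzq, ht]
        exact fun h => hqt (Fin.ext h)
      · rw [← hzq]
        cases Nat.beq z.1 y.1 <;> rfl
    by_cases hr : grp r = t
    · rw [if_pos hr]
      exact hq s hss hst
    · rw [if_neg hr]
      exact hq _ (h.isGrouping.idem r) hr

theorem length_contract_lt {l : List Table} (M : List (List Bool)) {x : Table} (hx : x ∈ l) (y : Table) :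
    (contract M l x y).length < l.length := by
  rw [contract, List.length_map]
  refine List.length_filter_lt_length_iff_exists.2 ⟨x, hx, ?_⟩
  simp

theorem IsContraction.length_le (h : IsContraction D grp l) : l.length ≤ N := by
  have : (l.map Prod.fst).toFinset ⊆ Finset.range N := by
    intro k hk
    obtain ⟨x, hx, rfl⟩ := List.mem_map.1 (List.mem_toFinset.1 hk)
    obtain ⟨t, ht, -⟩ := h.key x hx
    rw [ht]
    exact Finset.mem_range.2 t.2
  have := Finset.card_le_card this
  rwa [List.toFinset_card_of_nodup h.nodup, List.length_map, Finset.card_range] at this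

theorem mem_leaves_iff {l : List Table} (T : List (List Bool)) {x y : Table} : (x, y) ∈ leaves T l ↔
    x ∈ l ∧ y ∈ l ∧ entry T x.1 y.1 = true ∧ (l.countP fun z => entry T x.1 z.1) ≤ 1 := by
  simp [leaves, and_assoc]

variable [DecidableRel D.tree.Adj]

/-- Two tables mean two groups, so the tree of representatives has a leaf; as keys are distinct, the
test by counting detects it. -/
theorem IsContraction.leaves_ne_nil (h : IsContraction D grp l) (hl : 1 < l.length) :
    leaves (adjList D.tree) l ≠ [] := by
  obtain ⟨a, b, hab⟩ : ∃ a b, grp a ≠ grp b := by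
    by_contra! hall
    obtain ⟨x, hx⟩ := List.exists_mem_of_length_pos (by omega : 0 < l.length)
    obtain ⟨t, -, -⟩ := h.key x hx
    have : ∀ k ∈ l.map Prod.fst, k = (grp t).1 := by
      intro k hk
      obtain ⟨y, hy, rfl⟩ := List.mem_map.1 hk
      obtain ⟨s, hs, hs'⟩ := h.key y hy
      rw [hs, ← hs', hall s t]
    have hr := List.eq_replicate_of_mem this
    have hn := h.nodup
    rw [hr, List.nodup_replicate, List.length_map] at hn
    omega
  obtain ⟨t, s, ht, hs, hts, hleaf⟩ := h.isGrouping.exists_leaf D.isTree hab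
  obtain ⟨x, hx, hxt⟩ := h.exists_table t
  obtain ⟨y, hy, hys⟩ := h.exists_table s
  rw [ht] at hxt
  rw [hs] at hys
  refine List.ne_nil_of_mem ((mem_leaves_iff _).2 ⟨hx, hy, ?_, ?_⟩)
  · rw [hxt, hys, entry_adjList, decide_eq_true_iff]
    exact hts
  · rw [List.countP_eq_length_filter, hxt]
    set l' := l.filter fun z => entry (adjList D.tree) t z.1 with hl'
    have hnd : (l'.map Prod.fst).Nodup := h.nodup.sublist (List.filter_sublist.map _)
    have : ∀ k ∈ l'.map Prod.fst, k = s.1 := by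
      intro k hk
      obtain ⟨z, hz, rfl⟩ := List.mem_map.1 hk
      obtain ⟨hz, hzt⟩ := List.mem_filter.1 hz
      obtain ⟨r, hr, hr'⟩ := h.key z hz
      rw [hr, entry_adjList, decide_eq_true_iff] at hzt
      rw [hr, hleaf r hzt hr']
    rwa [List.eq_replicate_of_mem this, List.nodup_replicate, List.length_map] at hnd

theorem IsContraction.contractLeaf (h : IsContraction D grp l) :
    ∃ grp', IsContraction D grp' (contractLeaf (adjList G) (adjList D.tree) l) ∧
      (contractLeaf (adjList G) (adjList D.tree) l).length ≤ max 1 (l.length - 1) := by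
  rw [MinStableCut.contractLeaf]
  cases hL : leaves (adjList D.tree) l with
  | nil =>
    refine ⟨grp, h, ?_⟩
    have := Nat.le_of_not_lt fun hl => h.leaves_ne_nil hl hL
    simp only [List.isEmpty_nil, cond_true]
    omega
  | cons q L =>
    obtain ⟨x, y⟩ := q
    have hq : (x, y) ∈ leaves (adjList D.tree) l := by simp [hL]
    obtain ⟨hx, hy, hxy, hcount⟩ := (mem_leaves_iff _).1 hq
    obtain ⟨t, ht, ht'⟩ := h.key x hx
    obtain ⟨s, hs, hs'⟩ := h.key y hy
    refine ⟨_, h.contract hx hy ht hs ?_ fun r hr hr' => ?_, ?_⟩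
    · rwa [ht, hs, entry_adjList, decide_eq_true_iff] at hxy
    · obtain ⟨z, hz, hzr⟩ := h.exists_table r
      rw [hr'] at hzr
      -- At most one table is adjacent to `x`, and `y` is one.
      have hzy : z = y := by
        rw [List.countP_eq_length_filter] at hcount
        have h1 : z ∈ l.filter fun z => entry (adjList D.tree) x.1 z.1 :=
          List.mem_filter.2 ⟨hz, by rw [ht, hzr, entry_adjList, decide_eq_true_iff]; exact hr⟩
        have h2 : y ∈ l.filter fun z => entry (adjList D.tree) x.1 z.1 :=
          List.mem_filter.2 ⟨hy, hxy⟩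
        match h3 : l.filter fun z => entry (adjList D.tree) x.1 z.1 with
        | [] => simp [h3] at h1
        | [a] =>
          rw [h3] at h1 h2
          rw [List.mem_singleton.1 h1, List.mem_singleton.1 h2]
        | a :: b :: l'' => simp [h3] at hcount
      exact Fin.ext (by rw [← hzr, hzy, hs])
    · have := length_contract_lt (adjList G) hx y
      simp only [List.isEmpty_cons, cond_false, List.headD_cons]
      omega

theorem IsContraction.foldl (h : IsContraction D grp l) (k : ℕ) :
    ∃ grp', IsContraction D grp' ((List.range k).foldl
        (fun l _ => MinStableCut.contractLeaf (adjList G) (adjList D.tree) l) l) ∧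
      ((List.range k).foldl (fun l _ => MinStableCut.contractLeaf (adjList G) (adjList D.tree) l)
        l).length ≤ max 1 (N - k) := by
  induction k with
  | zero => exact ⟨grp, h, by have := h.length_le; simp; omega⟩
  | succ k ih =>
    obtain ⟨grp', h1, h2⟩ := ih
    obtain ⟨grp'', h3, h4⟩ := h1.contractLeaf
    rw [List.range_succ, List.foldl_append]
    exact ⟨grp'', h3, h4.trans (by omega)⟩

end Contraction

end MinStableCut

/-! ### The running time -/

namespace MinStableCut

open Enc
open scoped Finset

variable {n N : ℕ} {G : SimpleGraph (Fin n)} [DecidableRel G.Adj]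

theorem enc_ofFn {α : Type} [Enc α] {m : ℕ} (f : Fin m → α) :
    enc (List.ofFn f) = Data.ofList (List.ofFn fun i => enc (f i)) := by
  change Data.ofList ((List.ofFn f).map enc) = _
  rw [List.map_ofFn]
  rfl

/-- The input of the algorithm. -/
def inputOf (G : SimpleGraph (Fin n)) [DecidableRel G.Adj] (D : TreeDecomposition G (Fin N))
    [DecidableRel D.tree.Adj] : Input :=
  (adjList G, adjList D.tree, bagList D)

theorem enc_inputOf (D : TreeDecomposition G (Fin N)) [DecidableRel D.tree.Adj] :
    enc (inputOf G D) = encodeInstance G D := by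
  simp only [inputOf, enc_prod, adjList, bagList, enc_ofFn]
  rfl

theorem sz_bools (l : List Bool) : sz l = 2 * l.length + 1 := by
  induction l with
  | nil => rfl
  | cons b l ih =>
    rw [sz_cons, ih, List.length_cons, show sz b = 1 from rfl]
    omega

theorem sz_matrix {m : ℕ} (f : Fin m → Fin n → Bool) :
    sz (List.ofFn fun u => List.ofFn (f u)) ≤ m * (2 * n + 2) + 1 := by
  refine (sz_le_mul _ (2 * n + 1) fun l hl => ?_).trans (by rw [List.length_ofFn])
  obtain ⟨u, rfl⟩ := List.mem_ofFn.1 hl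
  rw [sz_bools, List.length_ofFn]

theorem sz_inputOf (D : TreeDecomposition G (Fin N)) [DecidableRel D.tree.Adj] :
    sz (inputOf G D) ≤ 3 * ((n + N) * (2 * (n + N) + 2)) + 5 := by
  have h1 := sz_matrix fun u v => decide (G.Adj u v)
  have h2 := sz_matrix fun u v => decide (D.tree.Adj u v)
  have h3 := sz_matrix fun t v => decide (v ∈ D.bag t)
  have h4 : n * (2 * n + 2) ≤ (n + N) * (2 * (n + N) + 2) := by gcongr <;> omega
  have h5 : N * (2 * N + 2) ≤ (n + N) * (2 * (n + N) + 2) := by gcongr <;> omega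
  have h6 : N * (2 * n + 2) ≤ (n + N) * (2 * (n + N) + 2) := by gcongr <;> omega
  simp only [inputOf, sz_prod, adjList, bagList]
  omega

/-- The bound for the size of lists of at most `N` tables of at most `K` cuts. -/
def tablesBound (n N K : ℕ) : ℕ :=
  N * (N + 2 * n + K * (2 * n + 2) + 6) + 1

theorem sz_tables_le {K : ℕ} {l : List Table} (hl : l.length ≤ N)
    (hkey : ∀ x ∈ l, ∃ t : Fin N, x.1 = t) (hvalid : ∀ x ∈ l, IsValid G K x) :
    sz l ≤ tablesBound n N K := by
  refine (sz_le_mul l (N + 2 * n + K * (2 * n + 2) + 5) fun x hx => ?_).trans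
    (Nat.add_le_add_right (Nat.mul_le_mul_right _ hl) 1)
  obtain ⟨t, ht⟩ := hkey x hx
  have hv := hvalid x hx
  have h1 : sz x.2.2 ≤ K * (2 * n + 2) + 1 :=
    (sz_le_mul x.2.2 (2 * n + 1) fun p hp => by rw [sz_bools, hv.length_cut p hp]).trans
      (Nat.add_le_add_right (Nat.mul_le_mul_right _ hv.length_le) 1)
  have h2 := t.2
  rw [sz_prod, sz_prod, sz_bools, hv.length_set, ht, sz_nat]
  omega

theorem exists_isContraction (D : TreeDecomposition G (Fin N)) [DecidableRel D.tree.Adj]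
    (hm : isMatching (adjList G) = false) :
    Affordable (inputOf G D) (tablesBound n N (tableBound G D.width)) ∧
      ∃ grp, IsContraction D grp (contractAll (inputOf G D)) ∧
        (contractAll (inputOf G D)).length ≤ 1 := by
  have hverts : introducedVertices (inputOf G D) = List.range n := by
    simp [introducedVertices, inputOf, hm]
  have hrounds : rounds (inputOf G D) = List.range N := by
    simp [rounds, inputOf, hm]
  have hinit : IsPartialBagTables D 0 (initialTables (inputOf G D)) := by
    have := isPartialBagTables_zero (D := D)
    simpa [initialTables, inputOf, hm] using this
  have hbags := isPartialBagTables_foldl hinit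
  have hall : IsContraction D (fun r => r) (bagTables (inputOf G D)) := by
    rw [bagTables, hverts]
    exact (hbags n le_rfl).isContraction
  refine ⟨⟨fun k => ?_, fun k => ?_⟩, ?_⟩
  · rw [hverts, List.take_range]
    have h := hbags (min k n) (min_le_right _ _)
    refine sz_tables_le ?_ (fun x hx => h.exists_key hx) h.valid
    have := congrArg List.length h.keys
    rw [List.length_map, List.length_range] at this
    exact this.le
  · rw [hrounds, List.take_range]
    obtain ⟨grp, h, -⟩ := hall.foldl (min k N)
    exact sz_tables_le h.length_le (fun x hx => (h.key x hx).imp fun _ => And.left) h.valid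
  · obtain ⟨grp, h1, h2⟩ := hall.foldl N
    rw [contractAll, hrounds]
    exact ⟨grp, h1, h2.trans (by omega)⟩

theorem IsContraction.headD_spec {D : TreeDecomposition G (Fin N)} {grp : Fin N → Fin N}
    {l : List Table} (h : IsContraction D grp l) (hl : l.length ≤ 1) :
    IsValid G (tableBound G D.width) (l.headD default) ∧
      ∀ v, bits n (l.headD default).2.1 v = true := by
  -- A tree has a node, so the list is not empty and has exactly one table.
  obtain ⟨r⟩ := D.isTree.connected.nonempty
  obtain ⟨x, hx, -⟩ := h.exists_table r
  have hlx : l = [x] := by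
    match l, hl, hx with
    | [y], _, hx => rw [List.mem_singleton.1 hx]
  subst hlx
  refine ⟨h.valid x hx, fun v => ?_⟩
  obtain ⟨t, ht, -⟩ := h.key x hx
  obtain ⟨q, hq⟩ := D.exists_mem_bag v
  refine (h.mem_iff x hx t ht v).2 ⟨q, ?_, hq⟩
  obtain ⟨y, hy, hyq⟩ := h.exists_table q
  rw [List.mem_singleton.1 hy, ht] at hyq
  exact Fin.ext hyq.symm

theorem solve_spec (D : TreeDecomposition G (Fin N)) [DecidableRel D.tree.Adj] :
    (solve (inputOf G D)).length = n ∧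
      IsUnweightedOptimal G (bits n (solve (inputOf G D))) ∧
      Affordable (inputOf G D) (tablesBound n N
        (if isMatching (adjList G) = true then 1 else tableBound G D.width)) := by
  suffices h : ∃ K, IsValid G K ((contractAll (inputOf G D)).headD default) ∧
      (∀ v, bits n ((contractAll (inputOf G D)).headD default).2.1 v = true) ∧
      Affordable (inputOf G D) (tablesBound n N
        (if isMatching (adjList G) = true then 1 else tableBound G D.width)) by
    obtain ⟨K, h1, h2, h3⟩ := h
    obtain ⟨h4, h5⟩ := best_spec h2 h1.represents
    exact ⟨h1.length_cut _ h4, h5, h3⟩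
  cases hm : isMatching (adjList G) with
  | false =>
    obtain ⟨h1, grp, h2, h3⟩ := exists_isContraction D hm
    obtain ⟨h4, h5⟩ := h2.headD_spec h3
    exact ⟨_, h4, h5, by simpa using h1⟩
  | true =>
    have hverts : introducedVertices (inputOf G D) = [] := by
      simp [introducedVertices, inputOf, hm]
    have hrounds : rounds (inputOf G D) = [] := by simp [rounds, inputOf, hm]
    have hinit : initialTables (inputOf G D) =
        [(0, constList (adjList G) true, [matchingCut (adjList G)])] := by
      simp [initialTables, inputOf, hm]
    have hbags : bagTables (inputOf G D) = initialTables (inputOf G D) := by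
      simp [bagTables, hverts]
    have hfull : ∀ v, bits n (constList (adjList G) true) v = true := bits_constList true
    have hvalid : IsValid G 1 (0, constList (adjList G) true, [matchingCut (adjList G)]) :=
      ⟨by simp [constList], by simp [matchingCut], le_rfl,
        represents_matchingCut (isMatching_iff.1 hm) hfull⟩
    -- This gives 1 ≤ `N`, so 0 is a legitimate key and one table fits into the bound.
    obtain ⟨r⟩ := D.isTree.connected.nonempty
    have hsz : sz (initialTables (inputOf G D)) ≤ tablesBound n N 1 := by
      rw [hinit]
      refine sz_tables_le (G := G) (by have := r.2; simp; omega) (fun x hx => ?_) fun x hx => ?_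
      · rw [List.mem_singleton.1 hx]
        exact ⟨⟨0, r.pos⟩, rfl⟩
      · rw [List.mem_singleton.1 hx]
        exact hvalid
    have hall : contractAll (inputOf G D) = initialTables (inputOf G D) := by
      simp [contractAll, hrounds, hbags]
    rw [hall, hinit]
    refine ⟨1, hvalid, hfull, fun k => ?_, fun k => ?_⟩
    · rw [hverts, List.take_nil]
      simpa using hsz
    · rw [hrounds, List.take_nil, hbags]
      simpa using hsz

/-- Outside of the matching case Δ ≥ 2, where 2(Δ+1) ≤ Δ³. The additional factor Δ³ from the
exponent `w + 1` goes into the polynomial in `n`, which keeps the exponent linear in `w` even for `w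
= 0`. -/
theorem tableBound_le (w : ℕ) :
    (if isMatching (adjList G) = true then 1 else tableBound G w) ≤
      (max G.maxDegree 1) ^ (3 * w) * (4 * (n + 1) ^ 5) := by
  have hpow : 0 < (max G.maxDegree 1) ^ (3 * w) := by positivity
  have hn : 0 < (n + 1) ^ 5 := by positivity
  by_cases hm : isMatching (adjList G) = true
  · rw [if_pos hm]
    exact Nat.mul_pos hpow (by omega)
  · rw [if_neg hm]
    obtain ⟨v, hv⟩ : ∃ v, 1 < G.degree v := by
      simpa only [isMatching_iff, not_forall, not_le] using hm
    have h1 : 2 ≤ G.maxDegree := hv.trans_le (G.degree_le_maxDegree v)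
    have h2 : G.maxDegree ≤ n + 1 :=
      G.maxDegree_le_of_forall_degree_le _ fun v =>
        (G.degree_lt_card_verts v).le.trans (by simp)
    have h3 : 2 * (G.maxDegree + 1) ≤ G.maxDegree ^ 3 := by nlinarith [mul_self_nonneg G.maxDegree]
    rw [max_eq_left (by omega)]
    calc tableBound G w ≤ (G.maxDegree ^ 3) ^ (w + 1) * (2 * (n * n + 1)) :=
          Nat.mul_le_mul_right _ (Nat.pow_le_pow_left h3 _)
      _ = G.maxDegree ^ (3 * w) * (G.maxDegree ^ 3 * (2 * (n * n + 1))) := by ring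
      _ ≤ G.maxDegree ^ (3 * w) * ((n + 1) ^ 3 * (4 * (n + 1) ^ 2)) := by
          gcongr
          · norm_num
          · nlinarith
      _ = _ := by ring

theorem size_bound {n N E K s : ℕ} (hN : 1 ≤ N) (hE : 1 ≤ E)
    (hK : K ≤ E * (4 * (n + 1) ^ 5)) (hs : s ≤ 3 * ((n + N) * (2 * (n + N) + 2)) + 5) :
    s + tablesBound n N K + 2 ≤ 100 * E * (n + N) ^ 7 := by
  set m := n + N with hm
  have hm1 : 1 ≤ m := by omega
  have hK' : K ≤ E * (4 * m ^ 5) :=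
    hK.trans (Nat.mul_le_mul_left _ (Nat.mul_le_mul_left _ (Nat.pow_le_pow_left (by omega) 5)))
  have h1 : tablesBound n N K ≤ m * (m + 2 * m + E * (4 * m ^ 5) * (2 * m + 2) + 6) + 1 := by
    unfold tablesBound
    gcongr <;> omega
  -- Every monomial is dominated by `E * m ^ 7`; with the monomials as atoms the claim becomes
  -- linear.
  have hp : ∀ i ≤ 7, m ^ i ≤ E * m ^ 7 := fun i hi =>
    (Nat.pow_le_pow_right hm1 hi).trans (Nat.le_mul_of_pos_left _ hE)
  have e0 := hp 0 (by omega)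
  have e1 := hp 1 (by omega)
  have e2 := hp 2 (by omega)
  have e6 : E * m ^ 6 ≤ E * m ^ 7 :=
    Nat.mul_le_mul_left _ (Nat.pow_le_pow_right hm1 (by omega))
  have h2 : m * (m + 2 * m + E * (4 * m ^ 5) * (2 * m + 2) + 6) + 1 =
      3 * m ^ 2 + 8 * (E * m ^ 7) + 8 * (E * m ^ 6) + 6 * m ^ 1 + m ^ 0 := by ring
  have h3 : 3 * (m * (2 * m + 2)) + 5 = 6 * m ^ 2 + 6 * m ^ 1 + 5 * m ^ 0 := by ring
  have h4 : 100 * E * m ^ 7 = 100 * (E * m ^ 7) := by ring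
  have h5 : 1 ≤ m ^ 0 := by simp
  rw [h4]
  omega

theorem exists_program_of_treeDecomposition : ∃ (p : Program) (c : ℕ),
    ∀ (n N : ℕ) (G : SimpleGraph (Fin n)) [DecidableRel G.Adj]
      (D : TreeDecomposition G (Fin N)) [DecidableRel D.tree.Adj],
      ∃ (side : Fin n → Bool) (t : ℕ),
        p.Outputs (encodeInstance G D) (Data.ofVector side) t ∧ IsUnweightedOptimal G side ∧
        t ≤ c * (max G.maxDegree 1) ^ (c * D.width) * (n + N) ^ c := by
  obtain ⟨p, c, hp⟩ := exists_program
  -- One constant serves as factor and in both exponents, so it has to be at least `100 ^ c`, `3 *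
  -- c` and `7 * c`.
  refine ⟨p, 100 ^ c + 10 * c, fun n N G _ D _ => ?_⟩
  obtain ⟨h1, h2, h3⟩ := solve_spec D
  obtain ⟨t, h4, h5⟩ := hp _ _ h3
  refine ⟨bits n (solve (inputOf G D)), t, ?_, h2, h5.trans ?_⟩
  · rw [← enc_inputOf]
    convert h4 using 1
    have : solve (inputOf G D) = List.ofFn (bits n (solve (inputOf G D))) := by
      refine List.ext_getElem (by simp [h1]) fun i hi _ => ?_
      simp [bits, bit, hi]
    conv_rhs => rw [this, enc_ofFn]
    rfl
  · obtain ⟨r⟩ := D.isTree.connected.nonempty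
    have hb := size_bound (s := sz (inputOf G D)) (by have := r.2; omega : 1 ≤ N)
      (Nat.one_le_iff_ne_zero.2 (by positivity)) (tableBound_le (G := G) D.width) (sz_inputOf D)
    have hm : 1 ≤ n + N := by have := r.2; omega
    calc _ ≤ (100 * (max G.maxDegree 1) ^ (3 * D.width) * (n + N) ^ 7) ^ c :=
          Nat.pow_le_pow_left hb c
      _ = 100 ^ c * (max G.maxDegree 1) ^ (3 * c * D.width) * (n + N) ^ (7 * c) := by
        rw [mul_pow, mul_pow, ← pow_mul, ← pow_mul, mul_right_comm 3]
      _ ≤ _ := by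
        gcongr
        · exact Nat.le_add_right _ _
        · exact le_max_right _ _
        · exact le_add_left (by omega)
        · exact le_add_left (by omega)

end MinStableCut

/-- A single program solves Unweighted Min Stable Cut on every graph with vertices `0, …, n - 1`
that is given with a tree decomposition with nodes `0, …, N - 1`, in time
`Δ ^ O(tw) * (n + N) ^ O(1)`; an edgeless graph counts as one with `Δ = 1`. -/
theorem corollary5p1 :
    ∃ (p : MinStableCut.Program) (c : ℕ),
      ∀ (n N : ℕ) (G : SimpleGraph (Fin n)) [DecidableRel G.Adj]
        (D : MinStableCut.TreeDecomposition G (Fin N)) [DecidableRel D.tree.Adj],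
        ∃ (side : Fin n → Bool) (t : ℕ),
          p.Outputs (MinStableCut.encodeInstance G D) (MinStableCut.Data.ofVector side) t ∧
          MinStableCut.IsUnweightedOptimal G side ∧
          t ≤ c * (max G.maxDegree 1) ^ (c * D.width) * (n + N) ^ c :=
  MinStableCut.exists_program_of_treeDecomposition
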